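/- Hypergraphs are finite. For a hypergraph $H$ with vertex set $V(H)$ and edge set $E(H)\subseteq 2^{V(H)}$, a hypergraph $M$ is a *hypergraph dilution* of $H$ if $M$ is isomorphic to a hypergraph obtained from $H$ by a finite (possibly empty) sequence of the following operations: (1) deleting a vertex from the vertex set and from all edges; (2) deleting an edge that is a proper subset of another edge; (3) *merging* on a vertex $v$: replacing all edges incident to $v$ by the single edge $\big(\bigcup_{e\ni v} e\big)\setminus\{v\}$, and removing $v$. A *conjunctive query* $q$ (without quantifiers) is a finite conjunction of relational atoms; its hypergraph has the variables of $q$ as vertices and, for every atom $R(x_1,\dots,x_n)$ of $q$, the edge $\{x_1,\dots,x_n\}$. For a database $D$ (a finite set of ground atoms) over the same schema, $q(D)$ is the set of all assignments of constants to the variables of $q$ under which every atom of $q$ becomes an element of $D$. For a class $\mathcal C$ of hypergraphs, $p\text{-}\#\mathrm{CQ}(\mathcal C)$ is the problem: given a conjunctive query $q$ whose hypergraph belongs to $\mathcal C$ and a database $D$ over the same schema, compute $|q(D)|$; the parameter is the hypergraph of $q$, considered up to isomorphism. **Theorem.** Let $\mathcal H$ be a recursively enumerable class of hypergraphs in which every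 vertex lies in at least one edge, and let $\mathcal M$ be a class of hypergraphs such that every member of $\mathcal M$ is a hypergraph dilution of a member of $\mathcal H$. Then $p\text{-}\#\mathrm{CQ}(\mathcal M)$ is fpt-reducible to $p\text{-}\#\mathrm{CQ}(\mathcal H)$ by a reduction that preserves the number of answers. That is, there are an algorithm, a constant $c$, and isomorphism-invariant functions $f,g$ from hypergraphs to $\mathbb N$ whose values on the parameters of the instances of $p\text{-}\#\mathrm{CQ}(\mathcal M)$ are computed by partial recursive functions, such that the algorithm transforms every instance $(q,D)$ of $p\text{-}\#\mathrm{CQ}(\mathcal M)$, with query hypergraph $M$, in time at most $f(M)\cdot\|(q,D)\|^{c}$ into an instance $(p,D')$ of $p\text{-}\#\mathrm{CQ}(\mathcal H)$ such that $|p(D')|=|q(D)|$ and the hypergraph $H'$ of $p$ satisfies $|V(H')|+|E(H')|\le g(M)$. -/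

import Mathlib

namespace CQDilution

/-! ### Hypergraphs and dilutions -/

/-- A finite hypergraph; vertices are named by natural numbers. -/
structure Hypergraph where
  verts : Finset ℕ
  edges : Finset (Finset ℕ)
  edges_subset : ∀ e ∈ edges, e ⊆ verts

namespace Hypergraph

/-- `I_v`, the set of edges incident to `v`. -/
def incident (H : Hypergraph) (v : ℕ) : Finset (Finset ℕ) :=
  H.edges.filter fun e => v ∈ e

/-- Every vertex lies in at least one edge. -/
def NoIsolated (H : Hypergraph) : Prop :=
  ∀ v ∈ H.verts, ∃ e ∈ H.edges, v ∈ e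

/-- Isomorphism of hypergraphs: a bijection of the vertex sets that maps the edge set of the one
onto the edge set of the other. -/
def Iso (H K : Hypergraph) : Prop :=
  ∃ φ : ℕ → ℕ, Set.InjOn φ H.verts ∧ H.verts.image φ = K.verts ∧
    H.edges.image (fun e => e.image φ) = K.edges

/-- Delete the vertex `v` from the vertex set and from all edges. -/
def deleteVertex (H : Hypergraph) (v : ℕ) : Hypergraph where
  verts := H.verts.erase v
  edges := H.edges.image fun e => e.erase v
  edges_subset := by
    intro e he
    obtain ⟨e', he', rfl⟩ := Finset.mem_image.mp he
    exact Finset.erase_subset_erase v (H.edges_subset e' he')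

/-- Delete the edge `e` (from the edge set only). -/
def deleteEdge (H : Hypergraph) (e : Finset ℕ) : Hypergraph where
  verts := H.verts
  edges := H.edges.erase e
  edges_subset := fun e' he' => H.edges_subset e' (Finset.mem_of_mem_erase he')

/-- Merging on `v`: all edges incident to `v` are replaced by the single edge
`(⋃ I_v) \ {v}`, and `v` disappears. -/
def merge (H : Hypergraph) (v : ℕ) : Hypergraph where
  verts := H.verts.erase v
  edges := insert (((H.incident v).biUnion id).erase v) (H.edges \ H.incident v)
  edges_subset := by
    intro e he
    rcases Finset.mem_insert.mp he with rfl | he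
    · apply Finset.erase_subset_erase
      refine Finset.biUnion_subset.mpr fun e' he' => ?_
      exact H.edges_subset e' (Finset.mem_filter.mp he').1
    · obtain ⟨h1, h2⟩ := Finset.mem_sdiff.mp he
      refine Finset.subset_erase.mpr ⟨H.edges_subset e h1, fun hv => h2 ?_⟩
      exact Finset.mem_filter.mpr ⟨h1, hv⟩

/-- `Step H K`: the hypergraph `K` results from `H` by one dilution operation. -/
inductive Step : Hypergraph → Hypergraph → Prop
  | deleteVertex (H : Hypergraph) (v : ℕ) (hv : v ∈ H.verts) : Step H (H.deleteVertex v)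
  | deleteEdge (H : Hypergraph) (e e' : Finset ℕ) (he : e ∈ H.edges) (he' : e' ∈ H.edges)
      (h : e ⊂ e') : Step H (H.deleteEdge e)
  | merge (H : Hypergraph) (v : ℕ) (hv : v ∈ H.verts) : Step H (H.merge v)

/-- `M` is a hypergraph dilution of `H`. -/
def IsDilutionOf (M H : Hypergraph) : Prop :=
  ∃ K, Relation.ReflTransGen Step H K ∧ Iso K M

/-- The lists `c.1` and `c.2` list the vertices and the edges of `H`, in any order and possibly
with repetitions. -/
def RepresentedBy (H : Hypergraph) (c : List ℕ × List (List ℕ)) : Prop :=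
  c.1.toFinset = H.verts ∧ (c.2.map List.toFinset).toFinset = H.edges

/-- A class of hypergraphs is recursively enumerable. -/
def IsRE (𝓗 : Set Hypergraph) : Prop :=
  REPred fun c : List ℕ × List (List ℕ) => ∃ H ∈ 𝓗, H.RepresentedBy c

/-- `f` is computable on the class `𝓜`: some partial recursive function sends every list
representation of every member `M` of `𝓜` to `f M`. -/
def ComputableOn (𝓜 : Set Hypergraph) (f : Hypergraph → ℕ) : Prop :=
  ∃ F : List ℕ × List (List ℕ) →. ℕ, Partrec F ∧
    ∀ M ∈ 𝓜, ∀ c, M.RepresentedBy c → f M ∈ F c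

/-- `f` depends only on the isomorphism type of its argument. -/
def IsoInvariant (f : Hypergraph → ℕ) : Prop :=
  ∀ H K, Iso H K → f H = f K

/-- The number of vertices plus the number of edges. -/
def size (H : Hypergraph) : ℕ := H.verts.card + H.edges.card

end Hypergraph

/-! ### Conjunctive queries and databases -/

/-- A relational atom: a relation symbol with a list of arguments. The arguments are variables
when the atom occurs in a query, and constants when it occurs in a database. Relation symbols,
variables and constants are named by natural numbers. -/
structure Atom where
  symbol : ℕ
  args : List ℕ

/-- A conjunctive query without quantifiers: a conjunction of relational atoms. -/
abbrev Query := List Atom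

/-- A database: a finite set of ground atoms, listed in any order. -/
abbrev Database := List Atom

/-- The variables of a query. -/
def Query.vars (q : Query) : Finset ℕ := (q.flatMap Atom.args).toFinset

/-- The hypergraph of a query: its vertices are the variables, its edges are the sets of variables
of the single atoms. -/
def Query.hypergraph (q : Query) : Hypergraph where
  verts := Query.vars q
  edges := (q.map fun a => a.args.toFinset).toFinset
  edges_subset := by
    intro e he
    obtain ⟨a, ha, rfl⟩ := List.mem_map.mp (List.mem_toFinset.mp he)
    intro x hx
    exact List.mem_toFinset.mpr (List.mem_flatMap.mpr ⟨a, ha, List.mem_toFinset.mp hx⟩)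

/-- The set `q(D)` of solutions: the assignments of constants to the variables of `q` under which
every atom of `q` becomes an element of `D`. -/
def Query.solutions (q : Query) (D : Database) : Set (Query.vars q → ℕ) :=
  {ν | ∃ μ : ℕ → ℕ, (∀ x : Query.vars q, μ x = ν x) ∧
    ∀ a ∈ q, (⟨a.symbol, a.args.map μ⟩ : Atom) ∈ D}

/-- The query and the database have a common schema: every relation symbol has one arity. -/
def SameSchema (q : Query) (D : Database) : Prop :=
  ∃ arity : ℕ → ℕ, (∀ a ∈ q, a.args.length = arity a.symbol) ∧
    ∀ a ∈ D, a.args.length = arity a.symbol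

/-! ### The model of computation

A small programming language on binary trees with an explicit running time. Every elementary
operation is charged the full size of the tree it works on, so that this running time is
polynomially related to that of multi-tape Turing machines; it bounds the sizes of all trees that
occur in the computation. -/

/-- The data of the programs: finite binary trees. -/
inductive Data where
  | nil : Data
  | cons (a b : Data) : Data

namespace Data

/-- The number of nodes. -/
def size : Data → ℕ
  | nil => 1
  | cons a b => a.size + b.size + 1

/-- The left subtree. -/
def fst : Data → Data
  | nil => nil
  | cons a _ => a

/-- The right subtree. -/
def snd : Data → Data
  | nil => nil
  | cons _ b => b

/-- Encoding of a truth value. -/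
def ofBool : Bool → Data
  | false => nil
  | true => cons nil nil

/-- Encoding of a list, for a given encoding of its entries. -/
def ofList {α : Type} (enc : α → Data) : List α → Data
  | [] => nil
  | a :: l => cons (enc a) (ofList enc l)

/-- Binary encoding of a natural number. -/
def ofNat (n : ℕ) : Data := ofList ofBool n.bits

/-- Encoding of an atom. -/
def ofAtom (a : Atom) : Data := cons (ofNat a.symbol) (ofList ofNat a.args)

end Data

/-- Programs. -/
inductive Prog where
  | nil : Prog
  | id : Prog
  | fst : Prog
  | snd : Prog
  | pair (p q : Prog) : Prog
  | comp (p q : Prog) : Prog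
  | cond (p q r : Prog) : Prog
  | loop (p q : Prog) : Prog

/-- `Runs p x y t`: the program `p`, started on the input `x`, halts with the output `y` after
time `t`. Here `comp p q` runs `p` and then `q`; `cond p q r` runs `q` if the output of `p` is not
`nil` and `r` otherwise; `loop p q` applies `q` as long as the output of `p` is not `nil`. -/
inductive Runs : Prog → Data → Data → ℕ → Prop
  | nil (x : Data) : Runs .nil x .nil x.size
  | id (x : Data) : Runs .id x x x.size
  | fst (x : Data) : Runs .fst x x.fst x.size
  | snd (x : Data) : Runs .snd x x.snd x.size
  | pair {p q : Prog} {x a b : Data} {s t : ℕ} (hp : Runs p x a s) (hq : Runs q x b t) :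
      Runs (.pair p q) x (.cons a b) (s + t + x.size)
  | comp {p q : Prog} {x y z : Data} {s t : ℕ} (hp : Runs p x y s) (hq : Runs q y z t) :
      Runs (.comp p q) x z (s + t + x.size)
  | cond_true {p q r : Prog} {x a b y : Data} {s t : ℕ} (hp : Runs p x (.cons a b) s)
      (hq : Runs q x y t) : Runs (.cond p q r) x y (s + t + x.size)
  | cond_false {p q r : Prog} {x y : Data} {s t : ℕ} (hp : Runs p x .nil s)
      (hr : Runs r x y t) : Runs (.cond p q r) x y (s + t + x.size)
  | loop_stop {p q : Prog} {x : Data} {s : ℕ} (hp : Runs p x .nil s) :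
      Runs (.loop p q) x x (s + x.size)
  | loop_step {p q : Prog} {x a b y z : Data} {s t u : ℕ} (hp : Runs p x (.cons a b) s)
      (hq : Runs q x y t) (h : Runs (.loop p q) y z u) :
      Runs (.loop p q) x z (s + t + u + x.size)

/-! ### Parameterised counting problems and fpt-reductions -/

/-- A counting problem, parameterised by a hypergraph. Only the inputs in `instances` are
admitted; on them the number `value` has to be computed. -/
structure ParamCountingProblem where
  Input : Type
  encode : Input → Data
  instances : Set Input
  value : Input → ℕ
  param : Input → Hypergraph

/-- The problem `p-#CQ(𝓒)`: given a conjunctive query `q` whose hypergraph is in `𝓒` and a database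
`D` over the same schema, determine `|q(D)|`; the parameter is the hypergraph of `q`. -/
noncomputable def pCountCQ (𝓒 : Set Hypergraph) : ParamCountingProblem where
  Input := Query × Database
  encode x := .cons (Data.ofList Data.ofAtom x.1) (Data.ofList Data.ofAtom x.2)
  instances := {x | Query.hypergraph x.1 ∈ 𝓒 ∧ SameSchema x.1 x.2}
  value x := (Query.solutions x.1 x.2).ncard
  param x := Query.hypergraph x.1

/-- `P` is fpt-reducible to `Q` by a reduction that preserves the number to be computed: a program
transforms every instance `x` of `P` with parameter `k` into an instance `y` of `Q` with the same
value, in time `f(k) * |x| ^ c`, such that the parameter of `y` has size at most `g(k)`. The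
functions `f` and `g` are computable on the parameters of the instances of `P`, and depend on
these hypergraphs only up to isomorphism. -/
def FptReducible (P Q : ParamCountingProblem) : Prop :=
  ∃ (p : Prog) (f g : Hypergraph → ℕ) (c : ℕ),
    Hypergraph.ComputableOn (P.param '' P.instances) f ∧ Hypergraph.IsoInvariant f ∧
    Hypergraph.ComputableOn (P.param '' P.instances) g ∧ Hypergraph.IsoInvariant g ∧
    ∀ x ∈ P.instances, ∃ y ∈ Q.instances, ∃ t : ℕ,
      Runs p (P.encode x) (Q.encode y) t ∧
      t ≤ f (P.param x) * (P.encode x).size ^ c ∧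
      (Q.param y).size ≤ g (P.param x) ∧
      Q.value y = P.value x

end CQDilution

/-! A sequence of dilution operations from `H` to `M` leaves a map `S` that sends vertices of `H` to
sets of vertices of `M`: deleting a vertex empties its set, merging on `v` gives `v` the whole
merged edge, and all other vertices keep themselves. Three properties of such maps survive
composition (`IsModel.trans`): every edge of `H` is sent into an edge of `M`, every edge of `M` is
the exact union of the sets along some edge of `H`, and the vertices whose sets contain a given `u`
hang together along edges of `H`. By `IsDilutionOf.exists_isModel` the operations themselves can
then be forgotten.

Let `S` be such a map and `(q, D)` an instance with hypergraph `M`. The new query has one atom, with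
its own relation symbol, for every listed edge of `H`; a variable `v` is to take the code of a tuple
of values for the variables in `S v`. The facts for an atom come from an atom `a₀` of `q` that
covers it and a fact of `D`, and are kept if the induced assignment satisfies all atoms of `q`
inside `a₀`. A solution of `q` yields a solution of the new query. Conversely, a solution of the new
query is a family of local assignments; connectivity and injectivity of the code make them agree,
and the exact covering of edges makes their union satisfy `q`. This bijection is
`ncard_solutions_eq`. Given `S`, the construction takes polynomial time (`PolyTime.result`).

It remains to find `H` and `S`. Stage `k` of a search inspects the `k`-th output of an enumeration
of the class and all connected relations between its vertices and the numbers below `k`, which stand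
for positions in the list of variables of `q`. Success depends only on the isomorphism type of `M`
(`found_candidates_iff`, `hasModel_iff_of_iso`), hence so does the first successful stage. The
enumeration is carried out by a program (`exists_prog_of_computable`), whose running times are
computable because programs compute partial recursive functions (`Prog.partrec_eval`). The sum of
these times up to the first successful stage provides both `f` and `g`. -/

namespace CQDilution

/-! ### Elementary facts on programs -/

theorem Data.one_le_size (x : Data) : 1 ≤ x.size := by
  cases x <;> simp [Data.size]

theorem Data.size_fst_le (x : Data) : x.fst.size ≤ x.size := by
  cases x <;> simp [Data.size, Data.fst]; omega

theorem Data.size_snd_le (x : Data) : x.snd.size ≤ x.size := by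
  cases x <;> simp [Data.size, Data.snd]; omega

theorem Runs.size_input_le {p : Prog} {x y : Data} {t : ℕ} (h : Runs p x y t) : x.size ≤ t := by
  cases h <;> omega

/-- Every operation is charged the size of its input, and only `pair` creates a new node, which this
charge pays for. A time bound is therefore also a size bound, and polynomial time is closed under
composition. -/
theorem Runs.size_output_le {p : Prog} {x y : Data} {t : ℕ} (h : Runs p x y t) : y.size ≤ t := by
  induction h with
  | nil x => exact x.one_le_size
  | id x => exact le_rfl
  | fst x => exact x.size_fst_le
  | snd x => exact x.size_snd_le
  | @pair p q x a b s t _ _ h1 h2 => have := x.one_le_size; simp only [Data.size]; omega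
  | comp => omega
  | cond_true => omega
  | cond_false => omega
  | loop_stop => omega
  | loop_step => omega

/-- Time bounds are polynomials over `ℕ` since these are monotone, so that size estimates can be
substituted into them. -/
theorem monotone_eval (P : Polynomial ℕ) : Monotone fun n : ℕ => P.eval n := by
  intro a b h
  induction P using Polynomial.induction_on' with
  | add p q hp hq => simpa using Nat.add_le_add hp hq
  | monomial n c => simpa using Nat.mul_le_mul_left c (Nat.pow_le_pow_left h n)

theorem eval_le_eval (P : Polynomial ℕ) {a b : ℕ} (h : a ≤ b) : P.eval a ≤ P.eval b :=
  monotone_eval P h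

/-- The rule for loops with an invariant and a decreasing measure. -/
theorem runs_loop {p q : Prog} {test step : Data → Data} {τ : ℕ} (Inv : Data → Prop)
    (m : Data → ℕ) (hp : ∀ s, Inv s → ∃ t ≤ τ, Runs p s (test s) t)
    (hq : ∀ s, Inv s → test s ≠ .nil →
      (∃ t ≤ τ, Runs q s (step s) t) ∧ Inv (step s) ∧ m (step s) < m s) (s : Data) (hs : Inv s) :
    ∃ y t, Runs (.loop p q) s y t ∧ Inv y ∧ test y = .nil ∧ t ≤ (m s + 1) * (3 * τ) := by
  induction h : m s using Nat.strong_induction_on generalizing s with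
  | _ n ih =>
    obtain ⟨t, ht, hr⟩ := hp s hs
    have hsz := hr.size_input_le
    cases hc : test s with
    | nil =>
      refine ⟨s, _, Runs.loop_stop (hc ▸ hr), hs, hc, ?_⟩
      nlinarith
    | cons a b =>
      obtain ⟨⟨u, hu, hr'⟩, hi, hm⟩ := hq s hs (by simp [hc])
      obtain ⟨y, v, hy, h1, h2, h3⟩ := ih _ (h ▸ hm) _ hi rfl
      refine ⟨y, _, .loop_step (hc ▸ hr) hr' hy, h1, h2, ?_⟩
      -- One round costs at most `3 * τ`: the test, the body and the charge for the state, which is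
      -- at most the time of the test.
      have : (m (step s) + 1 + 1) * (3 * τ) ≤ (n + 1) * (3 * τ) :=
        Nat.mul_le_mul_right _ (by omega)
      rw [Nat.add_mul _ 1] at this
      omega

/-! ### Functions computable in polynomial time -/

/-- `f` is computed by a program in polynomial time. -/
def PolyTime (f : Data → Data) : Prop :=
  ∃ (p : Prog) (P : Polynomial ℕ), ∀ x, ∃ t ≤ P.eval x.size, Runs p x (f x) t

namespace PolyTime

variable {f g h : Data → Data}

theorem size_le (hf : PolyTime f) : ∃ P : Polynomial ℕ, ∀ x, (f x).size ≤ P.eval x.size := by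
  obtain ⟨p, P, hP⟩ := hf
  refine ⟨P, fun x => ?_⟩
  obtain ⟨t, ht, hr⟩ := hP x
  exact hr.size_output_le.trans ht

theorem congr (hf : PolyTime f) (h : ∀ x, f x = g x) : PolyTime g := funext h ▸ hf

theorem id : PolyTime fun x => x := ⟨.id, .X, fun x => ⟨_, by simp, .id x⟩⟩

theorem nil : PolyTime fun _ => .nil := ⟨.nil, .X, fun x => ⟨_, by simp, .nil x⟩⟩

theorem comp (hg : PolyTime g) (hf : PolyTime f) : PolyTime fun x => g (f x) := by
  obtain ⟨p, P, hP⟩ := hf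
  obtain ⟨q, Q, hQ⟩ := hg
  refine ⟨.comp p q, P + Q.comp P + .X, fun x => ?_⟩
  obtain ⟨s, hs, hr⟩ := hP x
  obtain ⟨t, ht, hr'⟩ := hQ (f x)
  refine ⟨_, ?_, .comp hr hr'⟩
  have := eval_le_eval Q (hr.size_output_le.trans hs)
  simp only [Polynomial.eval_add, Polynomial.eval_comp, Polynomial.eval_X]
  omega

theorem fst (hf : PolyTime f) : PolyTime fun x => (f x).fst :=
  comp (g := Data.fst) ⟨.fst, .X, fun x => ⟨_, by simp, .fst x⟩⟩ hf

theorem snd (hf : PolyTime f) : PolyTime fun x => (f x).snd :=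
  comp (g := Data.snd) ⟨.snd, .X, fun x => ⟨_, by simp, .snd x⟩⟩ hf

theorem cons (hf : PolyTime f) (hg : PolyTime g) : PolyTime fun x => .cons (f x) (g x) := by
  obtain ⟨p, P, hP⟩ := hf
  obtain ⟨q, Q, hQ⟩ := hg
  refine ⟨.pair p q, P + Q + .X, fun x => ?_⟩
  obtain ⟨s, hs, hr⟩ := hP x
  obtain ⟨t, ht, hr'⟩ := hQ x
  refine ⟨_, ?_, .pair hr hr'⟩
  simp only [Polynomial.eval_add, Polynomial.eval_X]
  omega

theorem const (d : Data) : PolyTime fun _ => d := by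
  induction d with
  | nil => exact nil
  | cons a b ha hb => exact ha.cons hb

open Classical in
theorem ite_eq_nil (hf : PolyTime f) (hg : PolyTime g) (hh : PolyTime h) :
    PolyTime fun x => if f x = .nil then h x else g x := by
  obtain ⟨p, P, hP⟩ := hf
  obtain ⟨q, Q, hQ⟩ := hg
  obtain ⟨r, R, hR⟩ := hh
  refine ⟨.cond p q r, P + Q + R + .X, fun x => ?_⟩
  obtain ⟨s, hs, hp⟩ := hP x
  obtain ⟨t, ht, hq⟩ := hQ x
  obtain ⟨u, hu, hr⟩ := hR x
  simp only [Polynomial.eval_add, Polynomial.eval_X]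
  cases hc : f x with
  | nil =>
    rw [if_pos rfl]
    exact ⟨_, by omega, .cond_false (hc ▸ hp) hr⟩
  | cons a b =>
    rw [if_neg (by simp)]
    exact ⟨_, by omega, .cond_true (hc ▸ hp) hq⟩

/-- A polynomial-time body can still double its state in every round. The invariant therefore
remembers the original input `x`, and one polynomial `B` in its size bounds all states; it also
bounds the initial measure, hence the number of rounds. -/
theorem loop {init test step out : Data → Data} (hi : PolyTime init) (ht : PolyTime test)
    (hs : PolyTime step) (ho : PolyTime out) (Inv : Data → Data → Prop) (m : Data → ℕ) (B : Polynomial ℕ)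
    (h0 : ∀ x, Inv x (init x))
    (h1 : ∀ x s, Inv x s → test s ≠ .nil → Inv x (step s) ∧ m (step s) < m s)
    (hB : ∀ x s, Inv x s → s.size ≤ B.eval x.size) (hm : ∀ x, m (init x) ≤ B.eval x.size)
    (h2 : ∀ x s, Inv x s → test s = .nil → out s = f x) : PolyTime f := by
  suffices h : ∃ r : Data → Data, PolyTime r ∧ ∀ x, out (r x) = f x by
    obtain ⟨r, hr, hr'⟩ := h
    simpa only [hr'] using ho.comp hr
  obtain ⟨i, I, hI⟩ := hi
  obtain ⟨p, P, hP⟩ := ht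
  obtain ⟨q, Q, hQ⟩ := hs
  suffices h : ∀ x, ∃ y, out y = f x ∧ ∃ t ≤ (I + (B + 1) * (3 * ((P + Q).comp B)) + .X).eval x.size,
      Runs (.comp i (.loop p q)) x y t by
    choose r hr hr' using h
    exact ⟨r, ⟨_, _, hr'⟩, hr⟩
  intro x
  obtain ⟨s, hs, hr⟩ := hI x
  obtain ⟨y, t, hl, hy, hn, hle⟩ := runs_loop (p := p) (q := q) (test := test) (step := step)
    (τ := ((P + Q).comp B).eval x.size) (Inv x) m
    (fun s hs => by
      obtain ⟨t, ht, hr⟩ := hP s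
      refine ⟨t, ht.trans ?_, hr⟩
      have := eval_le_eval P (hB x s hs)
      simp only [Polynomial.eval_add, Polynomial.eval_comp]
      omega)
    (fun s hs hne => by
      refine ⟨?_, h1 x s hs hne⟩
      obtain ⟨t, ht, hr⟩ := hQ s
      refine ⟨t, ht.trans ?_, hr⟩
      have := eval_le_eval Q (hB x s hs)
      simp only [Polynomial.eval_add, Polynomial.eval_comp]
      omega) _ (h0 x)
  refine ⟨y, h2 x y hy hn, _, ?_, .comp hr hl⟩
  have h4 := Nat.mul_le_mul_right (3 * ((P + Q).comp B).eval x.size)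
    (Nat.add_le_add_right (hm x) 1)
  simp only [Polynomial.eval_add, Polynomial.eval_X, Polynomial.eval_mul, Polynomial.eval_one,
    Polynomial.eval_ofNat] at h4 hle ⊢
  omega

end PolyTime

/-! ### Lists -/

namespace Data

/-- The list of the entries on the right spine of a tree. -/
def toL : Data → List Data
  | nil => []
  | cons a b => a :: b.toL

/-- The tree with the given entries on its right spine. -/
def ofL : List Data → Data
  | [] => nil
  | a :: l => cons a (ofL l)

@[simp] theorem toL_ofL (l : List Data) : (ofL l).toL = l := by
  induction l with
  | nil => rfl
  | cons a l ih => simp [ofL, toL, ih]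

@[simp] theorem ofL_toL (d : Data) : ofL d.toL = d := by
  induction d with
  | nil => rfl
  | cons a b _ ih => simp [ofL, toL, ih]

@[simp] theorem toL_nil : toL nil = [] := rfl

@[simp] theorem toL_cons (a b : Data) : toL (cons a b) = a :: b.toL := rfl

theorem ofList_eq {α : Type} (enc : α → Data) (l : List α) : ofList enc l = ofL (l.map enc) := by
  induction l with
  | nil => rfl
  | cons a l ih => simp [ofList, ofL, ih]

@[simp] theorem toL_ofList {α : Type} (enc : α → Data) (l : List α) :
    (ofList enc l).toL = l.map enc := by
  rw [ofList_eq, toL_ofL]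

@[simp] theorem fst_cons (a b : Data) : (cons a b).fst = a := rfl

@[simp] theorem snd_cons (a b : Data) : (cons a b).snd = b := rfl

/-- The pairs of the entries of a list and the entries of a tree at equal positions. -/
def zipPad : List Data → Data → List Data
  | [], _ => []
  | a :: l, d => .cons a d.fst :: zipPad l d.snd

theorem size_ofL (l : List Data) : (ofL l).size = (l.map fun a => a.size + 1).sum + 1 := by
  induction l with
  | nil => rfl
  | cons a l ih => simp [ofL, size, ih]; omega

theorem size_eq_toL (d : Data) : d.size = (d.toL.map fun a => a.size + 1).sum + 1 := by
  rw [← size_ofL, ofL_toL]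

theorem length_toL_le (d : Data) : d.toL.length ≤ d.size := by
  induction d with
  | nil => simp
  | cons a b _ ih => simp [size]; omega

theorem size_lt_of_mem_toL {a d : Data} (h : a ∈ d.toL) : a.size < d.size := by
  induction d with
  | nil => simp at h
  | cons x b _ ih =>
    rw [toL_cons, List.mem_cons] at h
    rcases h with rfl | h
    · simp only [size]; omega
    · have := ih h; simp only [size]; omega

end Data

/-! ### List operations in polynomial time -/

namespace PolyTime

open Data

variable {l i : Data → Data}

/-- The loop state consists of the input, the accumulator and the unread part of the list. Since
iteration may blow up sizes, the accumulators of all prefixes have to be bounded in advance. -/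
theorem foldl {F : Data → Data → Data → Data} (hl : PolyTime l) (hi : PolyTime i)
    (hF : PolyTime fun z => F z.fst z.snd.fst z.snd.snd) (B : Polynomial ℕ)
    (hB : ∀ x l₁ l₂, (l x).toL = l₁ ++ l₂ → (l₁.foldl (F x) (i x)).size ≤ B.eval x.size) :
    PolyTime fun x => (l x).toL.foldl (F x) (i x) := by
  obtain ⟨L, hL⟩ := hl.size_le
  refine loop (out := fun s => s.snd.fst) (init := fun x => .cons x (.cons (i x) (l x))) (test := fun s => s.snd.snd)
    (step := fun s => .cons s.fst (.cons (F s.fst s.snd.fst s.snd.snd.fst) s.snd.snd.snd))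
    (id.cons (hi.cons hl)) id.snd.snd
    (id.fst.cons ((hF.comp (id.fst.cons (id.snd.fst.cons id.snd.snd.fst))).cons id.snd.snd.snd))
    id.snd.fst
    (fun x s => ∃ l₁ l₂, (l x).toL = l₁ ++ l₂ ∧
      s = .cons x (.cons (l₁.foldl (F x) (i x)) (ofL l₂)))
    (fun s => s.snd.snd.toL.length) (.X + B + L + 2) ?_ ?_ ?_ ?_ ?_
  · intro x
    exact ⟨[], (l x).toL, rfl, by simp⟩
  · rintro x s ⟨l₁, l₂, h, rfl⟩ hne
    cases l₂ with
    | nil => simp [ofL] at hne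
    | cons a l₂ => exact ⟨⟨l₁ ++ [a], l₂, by simp [h], by simp [ofL]⟩, by simp [ofL]⟩
  · rintro x s ⟨l₁, l₂, h, rfl⟩
    have h1 := hB x l₁ l₂ h
    have h2 := hL x
    rw [size_eq_toL, h] at h2
    simp only [List.map_append, List.sum_append] at h2
    simp only [size, size_ofL, Polynomial.eval_add, Polynomial.eval_X, Polynomial.eval_ofNat]
    omega
  · intro x
    have := (l x).length_toL_le
    have := hL x
    simp only [snd_cons, Polynomial.eval_add, Polynomial.eval_X, Polynomial.eval_ofNat]
    omega
  · rintro x s ⟨l₁, l₂, h, rfl⟩ hn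
    cases l₂ with
    | nil => simp [h, ofL]
    | cons a l₂ => simp [ofL] at hn

/-- A fold that conses builds its result backwards. The other list operations accept this and
reverse once at the end. -/
theorem reverseAux {f g : Data → Data} (hf : PolyTime f) (hg : PolyTime g) :
    PolyTime fun x => ofL ((f x).toL.reverseAux (g x).toL) := by
  have hfold : ∀ (l : List Data) (d : Data),
      l.foldl (fun acc a => Data.cons a acc) d = ofL (l.reverseAux d.toL) := by
    intro l
    induction l with
    | nil => simp
    | cons a l ih => intro d; simp [ih]
  obtain ⟨P, hP⟩ := hf.size_le
  obtain ⟨Q, hQ⟩ := hg.size_le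
  have := foldl (F := fun _ acc a => .cons a acc) hf hg (id.snd.snd.cons id.snd.fst) (P + Q) ?_
  · simpa only [hfold] using this
  · intro x l₁ l₂ h
    have h1 := hP x
    have h2 := hQ x
    rw [size_eq_toL] at h2
    rw [size_eq_toL, h] at h1
    rw [hfold, size_ofL, List.reverseAux_eq]
    simp only [List.map_append, List.sum_append, List.map_reverse, List.sum_reverse,
      Polynomial.eval_add] at *
    omega

theorem reverse (hl : PolyTime l) : PolyTime fun x => ofL (l x).toL.reverse := by
  simpa [List.reverseAux_eq] using hl.reverseAux nil

theorem append {f g : Data → Data} (hf : PolyTime f) (hg : PolyTime g) :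
    PolyTime fun x => ofL ((f x).toL ++ (g x).toL) := by
  simpa [List.reverseAux_eq] using hf.reverse.reverseAux hg

theorem flatMap {F : Data → Data → Data} (hl : PolyTime l)
    (hF : PolyTime fun z => F z.fst z.snd) :
    PolyTime fun x => ofL ((l x).toL.flatMap fun a => (F x a).toL) := by
  have hfold : ∀ (x : Data) (l : List Data) (d : Data),
      l.foldl (fun acc a => ofL ((F x a).toL.reverseAux acc.toL)) d =
        ofL ((l.flatMap fun a => (F x a).toL).reverseAux d.toL) := by
    intro x l
    induction l with
    | nil => simp
    | cons a l ih => intro d; rw [List.foldl_cons, ih]; simp [List.reverseAux_eq]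
  obtain ⟨P, hP⟩ := hl.size_le
  obtain ⟨Q, hQ⟩ := hF.size_le
  -- There are at most `P` entries, and each contributes a block computed from the pair of `x` and
  -- the entry, a tree of size at most `x.size + P + 1`.
  have key := foldl (F := fun x acc a => ofL ((F x a).toL.reverseAux acc.toL)) hl nil
    ((hF.comp (f := fun z => .cons z.fst z.snd.snd) (id.fst.cons id.snd.snd)).reverseAux id.snd.fst)
    (P * Q.comp (.X + P + 1) + 1) ?_
  · have h := key.reverse
    simp only [hfold] at h
    simpa [List.reverseAux_eq] using h
  · intro x l₁ l₂ h
    rw [hfold, size_ofL, List.reverseAux_eq]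
    simp only [toL_nil, List.append_nil, List.map_reverse, List.sum_reverse, Polynomial.eval_add, Polynomial.eval_mul, Polynomial.eval_comp, Polynomial.eval_X,
      Polynomial.eval_one, List.flatMap_def, List.map_flatten, List.sum_flatten, List.map_map, add_le_add_iff_right]
    have hlen : l₁.length ≤ P.eval x.size := by
      have h1 := (l x).length_toL_le
      have h2 := hP x
      rw [h, List.length_append] at h1
      omega
    refine (List.sum_le_card_nsmul _ (Q.eval (x.size + P.eval x.size + 1)) ?_).trans ?_
    · intro n hn
      obtain ⟨a, ha, rfl⟩ := List.mem_map.mp hn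
      have h1 : a.size < (l x).size := size_lt_of_mem_toL (by simp [h, ha])
      have h2 := hP x
      have h3 := hQ (.cons x a)
      have h4 := eval_le_eval Q (a := (Data.cons x a).size)
        (b := x.size + P.eval x.size + 1) (by simp only [size]; omega)
      have h5 := size_eq_toL (F x a)
      simp only [fst_cons, snd_cons] at h3
      simp only [Function.comp]
      omega
    · simpa using Nat.mul_le_mul_right _ hlen

theorem map {F : Data → Data → Data} (hl : PolyTime l) (hF : PolyTime fun z => F z.fst z.snd) :
    PolyTime fun x => ofL ((l x).toL.map (F x)) := by
  have := flatMap (F := fun x a => .cons (F x a) .nil) hl (hF.cons nil)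
  have h : ∀ x, ((l x).toL.flatMap fun a => [F x a]) = (l x).toL.map (F x) := by
    intro x
    induction (l x).toL <;> simp_all
  simpa [h] using this

theorem drop {f g : Data → Data} (hf : PolyTime f) (hg : PolyTime g) :
    PolyTime fun x => ofL ((f x).toL.drop (g x).toL.length) := by
  have hfold : ∀ (l : List Data) (d : Data),
      l.foldl (fun acc _ => Data.snd acc) d = ofL (d.toL.drop l.length) := by
    intro l
    induction l with
    | nil => simp
    | cons a l ih => intro d; rw [List.foldl_cons, ih]; cases d <;> simp [Data.snd]
  obtain ⟨P, hP⟩ := hf.size_le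
  have := foldl (F := fun _ acc _ => acc.snd) hg hf id.snd.fst.snd P ?_
  · simpa only [hfold] using this
  · intro x l₁ l₂ h
    refine le_trans ?_ (hP x)
    generalize f x = d
    induction l₁ generalizing d l₂ with
    | nil => exact le_rfl
    | cons a l₁ ih =>
      clear h
      refine le_trans ?_ d.size_snd_le
      rw [List.foldl_cons]
      clear ih
      generalize d.snd = d
      induction l₁ generalizing d with
      | nil => exact le_rfl
      | cons a l₁ ih => exact (ih _).trans d.size_snd_le

theorem zipPad {f g : Data → Data} (hf : PolyTime f) (hg : PolyTime g) :
    PolyTime fun x => ofL (Data.zipPad (f x).toL (g x)) := by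
  have hfold : ∀ (l : List Data) (d e : Data),
      (l.foldl (fun acc a => Data.cons acc.fst.snd (.cons (.cons a acc.fst.fst) acc.snd))
        (.cons d e)).snd = ofL ((Data.zipPad l d).reverse ++ e.toL) := by
    intro l
    induction l with
    | nil => simp [Data.zipPad]
    | cons a l ih => intro d e; simp [ih, Data.zipPad]
  obtain ⟨P, hP⟩ := hf.size_le
  obtain ⟨Q, hQ⟩ := hg.size_le
  have := foldl
    (F := fun _ acc a => Data.cons acc.fst.snd (.cons (.cons a acc.fst.fst) acc.snd))
    hf (hg.cons nil) (id.snd.fst.fst.snd.cons ((id.snd.snd.cons id.snd.fst.fst.fst).cons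
      id.snd.fst.snd)) (3 * P + Q + 2) ?_
  · simpa [hfold] using this.snd.reverse
  · intro x l₁ l₂ h
    have h1 := hP x
    have h2 := hQ x
    -- An entry adds its own size and at most three nodes; three occur when the second list is
    -- exhausted and `nil` is supplied.
    have hle : ∀ (l : List Data) (d e : Data),
        (l.foldl (fun acc a => Data.cons acc.fst.snd (.cons (.cons a acc.fst.fst) acc.snd))
          (.cons d e)).size ≤ (Data.cons d e).size + 3 * (l.map fun a => a.size + 1).sum := by
      intro l
      induction l with
      | nil => simp
      | cons a l ih =>
        intro d e
        refine (ih _ _).trans ?_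
        have := a.one_le_size
        cases d <;> simp only [size, Data.fst, Data.snd, List.map_cons, List.sum_cons] <;> omega
    have h3 := hle l₁ (g x) .nil
    rw [size_eq_toL, h] at h1
    simp only [List.map_append, List.sum_append] at h1
    simp only [size] at h3
    simp only [Polynomial.eval_add, Polynomial.eval_mul, Polynomial.eval_ofNat]
    omega

end PolyTime

/-! ### Predicates decidable in polynomial time -/

/-- `P` is decidable in polynomial time. -/
def PolyDec (P : Data → Prop) : Prop :=
  ∃ f, PolyTime f ∧ ∀ x, f x ≠ .nil ↔ P x

namespace PolyDec

open Data

variable {P Q : Data → Prop} {f g l : Data → Data}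

theorem congr (hP : PolyDec P) (h : ∀ x, P x ↔ Q x) : PolyDec Q := by
  obtain ⟨p, hp, hp'⟩ := hP
  exact ⟨p, hp, fun x => (hp' x).trans (h x)⟩

theorem ne_nil (hf : PolyTime f) : PolyDec fun x => f x ≠ .nil := ⟨f, hf, fun _ => Iff.rfl⟩

theorem _root_.CQDilution.PolyTime.ite [∀ x, Decidable (P x)] (hP : PolyDec P) (hf : PolyTime f) (hg : PolyTime g) :
    PolyTime fun x => if P x then f x else g x := by
  obtain ⟨p, hp, hp'⟩ := hP
  have := hp.ite_eq_nil hf hg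
  refine this.congr fun x => ?_
  by_cases h : P x
  · rw [if_pos h, if_neg ((hp' x).2 h)]
  · rw [if_neg h, if_pos (by simpa [h] using hp' x)]

theorem not (hP : PolyDec P) : PolyDec fun x => ¬ P x := by
  classical
  refine ⟨_, PolyTime.ite hP .nil (.const (.cons .nil .nil)), fun x => ?_⟩
  by_cases h : P x <;> simp [h]

theorem and (hP : PolyDec P) (hQ : PolyDec Q) : PolyDec fun x => P x ∧ Q x := by
  classical
  obtain ⟨q, hq, hq'⟩ := hQ
  refine ⟨_, PolyTime.ite hP hq .nil, fun x => ?_⟩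
  by_cases h : P x <;> simp [h, ← hq']

theorem or (hP : PolyDec P) (hQ : PolyDec Q) : PolyDec fun x => P x ∨ Q x := by
  refine (hP.not.and hQ.not).not.congr fun x => ?_
  tauto

/-- The answers of the tests are concatenated as lists; the result is `nil` exactly when every
answer is `nil`. -/
theorem exists_mem {R : Data → Data → Prop} (hl : PolyTime l)
    (hR : PolyDec fun z => R z.fst z.snd) : PolyDec fun x => ∃ a ∈ (l x).toL, R x a := by
  obtain ⟨r, hr, hr'⟩ := hR
  refine ⟨_, hl.flatMap (F := fun x a => r (.cons x a)) (hr.comp (.cons (.fst .id) (.snd .id))),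
    fun x => ?_⟩
  have h : ∀ d : Data, d.toL = [] ↔ d = .nil := fun d => by cases d <;> simp
  rw [ne_eq, ← h, toL_ofL, List.flatMap_eq_nil_iff]
  push Not
  refine exists_congr fun a => and_congr_right fun _ => ?_
  rw [ne_eq, h, ← ne_eq, hr' (.cons x a)]
  rfl

theorem forall_mem {R : Data → Data → Prop} (hl : PolyTime l)
    (hR : PolyDec fun z => R z.fst z.snd) : PolyDec fun x => ∀ a ∈ (l x).toL, R x a := by
  refine (exists_mem (R := fun x a => ¬ R x a) hl hR.not).not.congr fun x => ?_
  push Not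
  rfl

/-- The sum of the sizes of the entries of a list. -/
def total (d : Data) : ℕ := (d.toL.map Data.size).sum

theorem total_le (d : Data) : total d ≤ d.size := by
  rw [size_eq_toL, total]
  refine (List.sum_le_sum (g := fun a : Data => a.size + 1) fun a _ => ?_).trans (Nat.le_succ _)
  omega

/-- The first entry of a list is replaced by its two parts if it is not `nil`, and is removed
otherwise. -/
def unfoldHead : Data → Data
  | .cons (.cons a b) c => .cons a (.cons b c)
  | .cons .nil c => c
  | .nil => .nil

theorem unfoldHead_polyTime (hf : PolyTime f) : PolyTime fun x => unfoldHead (f x) := by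
  refine (hf.fst.ite_eq_nil (hf.fst.fst.cons (hf.fst.snd.cons hf.snd)) hf.snd).congr fun x => ?_
  rcases f x with _ | ⟨_ | ⟨a, b⟩, c⟩ <;> simp [unfoldHead, Data.fst, Data.snd]

theorem size_unfoldHead_le (s : Data) : (unfoldHead s).size ≤ s.size := by
  rcases s with _ | ⟨_ | ⟨a, b⟩, c⟩ <;> simp only [unfoldHead, size] <;> omega

/-- Splitting a pair at the head leaves the size of the whole tree unchanged, so size cannot serve
as a measure. The total of the entry sizes drops, because the node of the pair is gone. -/
theorem total_unfoldHead_lt (s : Data) (h : s ≠ .nil) : total (unfoldHead s) < total s := by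
  rcases s with _ | ⟨_ | ⟨a, b⟩, c⟩ <;>
    simp only [unfoldHead, total, size, toL_cons, List.map_cons, List.sum_cons] at *
  · contradiction
  · omega
  · omega

/-- The two trees start as one-element stacks, which are unfolded in parallel as long as both are
nonempty and their heads have the same shape. Equality of the stacks remains equivalent to equality
of the trees. When the loop stops, the stacks are equal only if both are empty. -/
theorem eq (hf : PolyTime f) (hg : PolyTime g) : PolyDec fun x => f x = g x := by
  classical
  have hnil : ∀ {k : Data → Data}, PolyTime k → PolyDec fun x => k x = .nil := fun hk =>
    (ne_nil hk).not.congr fun x => by simp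
  obtain ⟨T, hT, hT'⟩ : PolyDec fun s => (s.fst ≠ .nil ∧ s.snd ≠ .nil) ∧
      ((s.fst.fst = .nil ∧ s.snd.fst = .nil) ∨ (s.fst.fst ≠ .nil ∧ s.snd.fst ≠ .nil)) :=
    ((ne_nil (.fst .id)).and (ne_nil (.snd .id))).and
      (((hnil (.fst (.fst .id))).and (hnil (.fst (.snd .id)))).or
        ((ne_nil (.fst (.fst .id))).and (ne_nil (.fst (.snd .id)))))
  obtain ⟨P, hP⟩ := ((hf.cons .nil).cons (hg.cons .nil)).size_le
  refine ⟨fun x => if f x = g x then .cons .nil .nil else .nil, ?_, fun x => by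
    by_cases h : f x = g x <;> simp [h]⟩
  refine .loop (init := fun x => .cons (.cons (f x) .nil) (.cons (g x) .nil)) (test := T)
    (step := fun s => .cons (unfoldHead s.fst) (unfoldHead s.snd))
    (out := fun s => if s.fst = .nil ∧ s.snd = .nil then .cons .nil .nil else .nil)
    ((hf.cons .nil).cons (hg.cons .nil)) hT
    ((unfoldHead_polyTime (.fst .id)).cons (unfoldHead_polyTime (.snd .id)))
    (.ite ((hnil (.fst .id)).and (hnil (.snd .id))) (.const _) .nil)
    (fun x s => s.size ≤ (Data.cons (.cons (f x) .nil) (.cons (g x) .nil)).size ∧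
      (∃ a b, s = .cons a b) ∧ (s.fst = s.snd ↔ f x = g x))
    (fun s => total s.fst) P ?_ ?_ ?_ ?_ ?_
  · exact fun x => ⟨le_rfl, ⟨_, _, rfl⟩, by simp⟩
  · rintro x s ⟨h1, ⟨a, b, rfl⟩, h2⟩ h3
    rw [hT'] at h3
    simp only [fst_cons, snd_cons] at *
    refine ⟨⟨?_, ⟨_, _, rfl⟩, ?_⟩, total_unfoldHead_lt _ h3.1.1⟩
    · have h4 := size_unfoldHead_le a
      have h5 := size_unfoldHead_le b
      simp only [size] at *
      omega
    · rw [← h2]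
      rcases a with _ | ⟨_ | ⟨a, a'⟩, c⟩ <;> rcases b with _ | ⟨_ | ⟨b, b'⟩, d⟩ <;>
        simp_all [unfoldHead, Data.fst, and_assoc]
  · exact fun x s hs => hs.1.trans (hP x)
  · intro x
    have h1 := hP x
    have h2 := total_le (.cons (f x) .nil)
    simp only [size, fst_cons] at *
    omega
  · rintro x s ⟨h1, ⟨a, b, rfl⟩, h2⟩ h3
    have h4 := (hT' (.cons a b)).not.mp (by simp [h3])
    simp only [fst_cons, snd_cons, ← h2] at *
    rcases a with _ | ⟨_ | ⟨a, a'⟩, c⟩ <;> rcases b with _ | ⟨_ | ⟨b, b'⟩, d⟩ <;>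
        simp_all [Data.fst]

theorem mem (hf : PolyTime f) (hl : PolyTime l) : PolyDec fun x => f x ∈ (l x).toL :=
  (exists_mem (R := fun x a => a = f x) hl (eq (.snd .id) (hf.comp (.fst .id)))).congr
    fun x => by simp

theorem subset (hf : PolyTime f) (hl : PolyTime l) :
    PolyDec fun x => ∀ a ∈ (f x).toL, a ∈ (l x).toL :=
  forall_mem hf (mem (.snd .id) (hl.comp (.fst .id)))

end PolyDec

/-- Entries of a list that satisfy a predicate decidable in polynomial time. -/
theorem PolyTime.filter {l : Data → Data} {R : Data → Data → Prop} (hl : PolyTime l)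
    (hR : PolyDec fun z => R z.fst z.snd) [∀ x a, Decidable (R x a)] :
    PolyTime fun x => Data.ofL ((l x).toL.filter fun a => R x a) := by
  classical
  refine (hl.flatMap (F := fun x a => if R x a then .cons a .nil else .nil)
    (.ite hR (.cons (.snd .id) .nil) .nil)).congr fun x => ?_
  congr 1
  induction (l x).toL with
  | nil => rfl
  | cons a l ih => by_cases h : R x a <;> simp [h, ih]

/-! ### Binary trees as codes for computable functions -/

namespace Data

/-- The number of a tree. -/
def toNat : Data → ℕ
  | nil => 0
  | cons a b => Nat.pair a.toNat b.toNat + 1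

/-- The tree with a given number. -/
def fromNat : ℕ → Data
  | 0 => nil
  | n + 1 =>
    have : n.unpair.1 < n + 1 := Nat.lt_succ_of_le (Nat.unpair_left_le n)
    have : n.unpair.2 < n + 1 := Nat.lt_succ_of_le (Nat.unpair_right_le n)
    cons (fromNat n.unpair.1) (fromNat n.unpair.2)

theorem fromNat_toNat (d : Data) : fromNat d.toNat = d := by
  induction d with
  | nil => rw [toNat, fromNat]
  | cons a b ha hb => rw [toNat, fromNat]; simp [ha, hb]

theorem toNat_fromNat (n : ℕ) : (fromNat n).toNat = n := by
  induction n using Nat.strong_induction_on with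
  | _ n ih =>
    cases n with
    | zero => rw [fromNat, toNat]
    | succ n =>
      rw [fromNat, toNat, ih _ (Nat.lt_succ_of_le (Nat.unpair_left_le n)),
        ih _ (Nat.lt_succ_of_le (Nat.unpair_right_le n)), Nat.pair_unpair]

/-- Trees correspond to natural numbers. -/
def equivNat : Data ≃ ℕ := ⟨toNat, fromNat, fromNat_toNat, toNat_fromNat⟩

instance : Primcodable Data := Primcodable.ofEquiv ℕ equivNat

theorem primrec_toNat : Primrec toNat := Primrec.of_equiv (e := equivNat)

theorem primrec_fromNat : Primrec fromNat := Primrec.of_equiv_symm (e := equivNat)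

theorem primrec_cons : Primrec₂ cons := by
  have h : Primrec fun x : Data × Data => fromNat (Nat.pair x.1.toNat x.2.toNat + 1) :=
    primrec_fromNat.comp (Primrec.succ.comp (Primrec₂.natPair.comp
      (primrec_toNat.comp .fst) (primrec_toNat.comp .snd)))
  refine h.of_eq fun x => ?_
  rw [fromNat]
  simp [fromNat_toNat]

theorem primrec_fst : Primrec fst := by
  have h : Primrec fun x : Data => fromNat (Nat.casesOn x.toNat 0 fun n => n.unpair.1 : ℕ) :=
    primrec_fromNat.comp (Primrec.nat_casesOn primrec_toNat (.const 0)
      (Primrec.fst.comp (Primrec.unpair.comp .snd)).to₂)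
  refine h.of_eq fun x => ?_
  cases x with
  | nil => simp [toNat, fromNat, fst]
  | cons a b => simp [toNat, fst, fromNat_toNat]

theorem primrec_snd : Primrec snd := by
  have h : Primrec fun x : Data => fromNat (Nat.casesOn x.toNat 0 fun n => n.unpair.2 : ℕ) :=
    primrec_fromNat.comp (Primrec.nat_casesOn primrec_toNat (.const 0)
      (Primrec.snd.comp (Primrec.unpair.comp .snd)).to₂)
  refine h.of_eq fun x => ?_
  cases x with
  | nil => simp [toNat, fromNat, snd]
  | cons a b => simp [toNat, snd, fromNat_toNat]

/-- Structural recursion on trees is primitive recursive. -/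
theorem primrec_rec {σ : Type} [Primcodable σ] [Inhabited σ] {f : Data → σ} (g : σ → σ → σ)
    (hg : Primrec₂ g) (h : ∀ a b, f (cons a b) = g (f a) (f b)) : Primrec f := by
  have key : Primrec fun n : ℕ => f (fromNat n) := by
    -- The history `l` has the current code as its length, so it is empty exactly at the code of
    -- `nil`. The codes of both subtrees are smaller, so that the default of `getD` is never used.
    have := Primrec.nat_strong_rec (α := Unit) (σ := σ) (fun _ n => f (fromNat n))
      (g := fun _ l => some (Nat.casesOn l.length (f nil) fun n =>
        g (l.getD n.unpair.1 default) (l.getD n.unpair.2 default) : σ)) ?_ ?_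
    · exact (this.comp (.const ()) .id)
    · refine Primrec.option_some.comp (Primrec.nat_casesOn (Primrec.list_length.comp .snd)
        (.const _) (hg.comp ((Primrec.list_getD default).comp (.comp .snd .fst)
          (Primrec.fst.comp (Primrec.unpair.comp .snd))) ((Primrec.list_getD default).comp
          (.comp .snd .fst) (Primrec.snd.comp (Primrec.unpair.comp .snd)))).to₂)
    · intro _ n
      cases n with
      | zero => simp [fromNat]
      | succ n =>
        have h1 := Nat.lt_succ_of_le (Nat.unpair_left_le n)
        have h2 := Nat.lt_succ_of_le (Nat.unpair_right_le n)
        simp only [List.length_map, List.length_range]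
        rw [fromNat, h, List.getD_eq_getElem _ _ (by simpa using h1),
          List.getD_eq_getElem _ _ (by simpa using h2)]
        simp
  exact (key.comp primrec_toNat).of_eq fun x => by rw [fromNat_toNat]

theorem primrec_size : Primrec size :=
  primrec_rec (fun a b => a + b + 1) (Primrec.succ.comp (Primrec.nat_add.comp .fst .snd))
    fun _ _ => rfl

theorem primrec_ofList {α : Type} [Primcodable α] {enc : α → Data} (h : Primrec enc) :
    Primrec (ofList enc) := by
  have := Primrec.list_foldr (f := fun l : List α => l) (g := fun _ => nil)
    (h := fun _ x => cons (enc x.1) x.2) .id (.const nil)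
    (primrec_cons.comp (h.comp (.comp .fst .snd)) (.comp .snd .snd)).to₂
  refine this.of_eq fun l => ?_
  induction l with
  | nil => rfl
  | cons a l ih => rw [List.foldr_cons, ih]; rfl

/-- The least significant digit of `n` is its parity and the remaining ones are those of `n / 2`,
which is a course-of-values recursion. -/
theorem primrec_ofNat : Primrec ofNat := by
  have := Primrec.nat_strong_rec (α := Unit) (σ := Data) (fun _ n => ofNat n)
    (g := fun _ l => some (if l.length = 0 then nil else
      cons (if l.length % 2 = 1 then cons nil nil else nil) (l.getD (l.length / 2) nil))) ?_ ?_
  · exact (this.comp (.const ()) .id)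
  · have hl : Primrec fun x : Unit × List Data => x.2.length := Primrec.list_length.comp .snd
    refine Primrec.option_some.comp (Primrec.ite (Primrec.eq.comp hl (.const 0)) (.const _)
      (primrec_cons.comp (Primrec.ite (Primrec.eq.comp (Primrec.nat_mod.comp hl (.const 2))
        (.const 1)) (.const _) (.const _)) ((Primrec.list_getD nil).comp .snd
        (Primrec.nat_div.comp hl (.const 2)))))
  · intro _ n
    simp only [List.length_map, List.length_range, Option.some.injEq]
    by_cases hn : n = 0
    · subst hn; rfl
    · rw [if_neg hn, List.getD_eq_getElem _ _ (by simp; omega)]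
      conv_rhs => rw [← Nat.bit_bodd_div2 n, ofNat, Nat.bits_append_bit _ _ (by
        intro h
        by_contra hb
        apply hn
        rw [← Nat.bit_bodd_div2 n, h]
        simp at hb
        simp [hb])]
      simp only [List.getElem_map, List.getElem_range, ofList, Nat.div2_val, Nat.mod_two_of_bodd]
      cases n.bodd <;> simp [ofBool, ofNat]

theorem primrec_ofAtom {α : Type} [Primcodable α] {s : α → ℕ} {a : α → List ℕ} (hs : Primrec s)
    (ha : Primrec a) : Primrec fun x => ofAtom ⟨s x, a x⟩ :=
  primrec_cons.comp (primrec_ofNat.comp hs) ((primrec_ofList primrec_ofNat).comp ha)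

end Data

/-! ### Programs compute partial recursive functions -/

/-- One step of a loop, with a record of the time spent so far. -/
def Prog.loopStep (F G : Data →. Data × ℕ) (z : Data × ℕ) : Part ((Data × ℕ) ⊕ (Data × ℕ)) :=
  (F z.1).bind fun a =>
    bif decide (a.1.size = 1) then Part.some (Sum.inl (z.1, z.2 + (a.2 + z.1.size)))
    else (G z.1).bind fun b => Part.some (Sum.inr (b.1, z.2 + (a.2 + b.2 + z.1.size)))

/-- The partial function that sends an input to the output and the running time. -/
def Prog.eval : Prog → Data →. Data × ℕ
  | .nil => fun x => Part.some (.nil, x.size)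
  | .id => fun x => Part.some (x, x.size)
  | .fst => fun x => Part.some (x.fst, x.size)
  | .snd => fun x => Part.some (x.snd, x.size)
  | .pair p q => fun x => (p.eval x).bind fun a => (q.eval x).bind fun b =>
      Part.some (.cons a.1 b.1, a.2 + b.2 + x.size)
  | .comp p q => fun x => (p.eval x).bind fun a => (q.eval a.1).bind fun b =>
      Part.some (b.1, a.2 + b.2 + x.size)
  | .cond p q r => fun x => (p.eval x).bind fun a =>
      (bif decide (a.1.size = 1) then r.eval x else q.eval x).bind fun b =>
        Part.some (b.1, a.2 + b.2 + x.size)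
  | .loop p q => fun x => PFun.fix (Prog.loopStep p.eval q.eval) (x, 0)

theorem computable_charge {α : Type} [Primcodable α] {x : α → Data} {a b : α → Data × ℕ}
    (hx : Computable x) (ha : Computable a) (hb : Computable b) :
    Computable fun z => (a z).2 + (b z).2 + (x z).size :=
  Primrec.nat_add.to_comp.comp (Primrec.nat_add.to_comp.comp (Computable.snd.comp ha)
    (Computable.snd.comp hb)) (Data.primrec_size.to_comp.comp hx)

theorem partrec_two_steps {F : Data →. Data × ℕ} {G : Data × (Data × ℕ) →. Data × ℕ}
    {h : Data → Data → Data} (hF : Partrec F) (hG : Partrec G) (hh : Computable₂ h) :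
    Partrec fun x => (F x).bind fun a => (G (x, a)).bind fun b =>
      Part.some (h a.1 b.1, a.2 + b.2 + x.size) := by
  have h1 : Computable fun z : (Data × (Data × ℕ)) × (Data × ℕ) => z.1.2 :=
    Computable.snd.comp Computable.fst
  have h2 : Computable fun z : (Data × (Data × ℕ)) × (Data × ℕ) => z.2 := Computable.snd
  have h3 : Computable fun z : (Data × (Data × ℕ)) × (Data × ℕ) => z.1.1 :=
    Computable.fst.comp Computable.fst
  have h4 := (hh.comp (Computable.fst.comp h1) (Computable.fst.comp h2)).pair
    (computable_charge h3 h1 h2)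
  have h5 : Partrec fun y : Data × (Data × ℕ) => (G y).bind fun b =>
      Part.some (h y.2.1 b.1, y.2.2 + b.2 + y.1.size) := hG.bind h4.partrec.to₂
  exact hF.bind h5.to₂

/-- `nil` is the only tree of size one; this is how `Prog.eval` tests for it. -/
theorem computable_size_eq_one {α : Type} [Primcodable α] {f : α → Data} (hf : Computable f) :
    Computable fun x => decide ((f x).size = 1) :=
  (Primrec.eq.decide.to_comp.comp (Data.primrec_size.to_comp.comp hf) (.const 1)).of_eq
    fun _ => by simp

/-- The running time is part of the value because the bounds of the reduction are sums of running
times and have to be computable. -/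
theorem Prog.partrec_eval (p : Prog) : Partrec p.eval := by
  induction p with
  | nil => exact ((Computable.const Data.nil).pair Data.primrec_size.to_comp).partrec
  | id => exact (Computable.id.pair Data.primrec_size.to_comp).partrec
  | fst => exact (Data.primrec_fst.to_comp.pair Data.primrec_size.to_comp).partrec
  | snd => exact (Data.primrec_snd.to_comp.pair Data.primrec_size.to_comp).partrec
  | pair p q hp hq =>
    exact partrec_two_steps (G := fun y => q.eval y.1) hp (hq.comp Computable.fst)
      Data.primrec_cons.to_comp
  | comp p q hp hq =>
    exact partrec_two_steps (G := fun y => q.eval y.2.1) (h := fun _ b => b) hp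
      (hq.comp (Computable.fst.comp Computable.snd)) Computable.snd.to₂
  | cond p q r hp hq hr =>
    have hG : Partrec fun y : Data × (Data × ℕ) =>
        bif decide (y.2.1.size = 1) then r.eval y.1 else q.eval y.1 :=
      Partrec.cond (computable_size_eq_one (Computable.fst.comp Computable.snd))
        (hr.comp Computable.fst) (hq.comp Computable.fst)
    exact partrec_two_steps (h := fun _ b => b) hp hG Computable.snd.to₂
  | loop p q hp hq =>
    have hA : Computable fun y : (Data × ℕ) × (Data × ℕ) =>
        (Sum.inl (y.1.1, y.1.2 + (y.2.2 + y.1.1.size)) : (Data × ℕ) ⊕ (Data × ℕ)) := by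
      have h1 : Computable fun y : (Data × ℕ) × (Data × ℕ) => y.1.1 :=
        Computable.fst.comp Computable.fst
      have h2 : Computable fun y : (Data × ℕ) × (Data × ℕ) => y.1.2 :=
        Computable.snd.comp Computable.fst
      have h3 : Computable fun y : (Data × ℕ) × (Data × ℕ) => y.2.2 :=
        Computable.snd.comp Computable.snd
      exact Computable.sumInl.comp (h1.pair (Primrec.nat_add.to_comp.comp h2
        (Primrec.nat_add.to_comp.comp h3 (Data.primrec_size.to_comp.comp h1))))
    have hB : Computable fun y : ((Data × ℕ) × (Data × ℕ)) × (Data × ℕ) =>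
        (Sum.inr (y.2.1, y.1.1.2 + (y.1.2.2 + y.2.2 + y.1.1.1.size)) :
          (Data × ℕ) ⊕ (Data × ℕ)) := by
      have h0 : Computable fun y : ((Data × ℕ) × (Data × ℕ)) × (Data × ℕ) => y.1.1 :=
        Computable.fst.comp Computable.fst
      have h1 : Computable fun y : ((Data × ℕ) × (Data × ℕ)) × (Data × ℕ) => y.1.2 :=
        Computable.snd.comp Computable.fst
      have h2 : Computable fun y : ((Data × ℕ) × (Data × ℕ)) × (Data × ℕ) => y.2 :=
        Computable.snd
      exact Computable.sumInr.comp ((Computable.fst.comp h2).pair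
        (Primrec.nat_add.to_comp.comp (Computable.snd.comp h0)
          (computable_charge (Computable.fst.comp h0) h1 h2)))
    have hC : Partrec fun y : (Data × ℕ) × (Data × ℕ) => (q.eval y.1.1).bind fun b =>
        Part.some (Sum.inr (b.1, y.1.2 + (y.2.2 + b.2 + y.1.1.size)) :
          (Data × ℕ) ⊕ (Data × ℕ)) :=
      Partrec.bind (hq.comp (Computable.fst.comp Computable.fst)) hB.partrec.to₂
    have hD : Partrec fun y : (Data × ℕ) × (Data × ℕ) =>
        bif decide (y.2.1.size = 1) then
          Part.some (Sum.inl (y.1.1, y.1.2 + (y.2.2 + y.1.1.size)) : (Data × ℕ) ⊕ (Data × ℕ))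
        else (q.eval y.1.1).bind fun b =>
          Part.some (Sum.inr (b.1, y.1.2 + (y.2.2 + b.2 + y.1.1.size))) :=
      Partrec.cond (computable_size_eq_one (Computable.fst.comp Computable.snd)) hA.partrec hC
    have hE := Partrec.fix (Partrec.bind (hp.comp Computable.fst) hD.to₂)
    exact hE.comp (Computable.id.pair (Computable.const 0))

theorem decide_size_cons (a b : Data) : decide ((Data.cons a b).size = 1) = false := by
  have := a.one_le_size
  simp [Data.size]; omega

/-- The clock is only ever increased and never influences the control flow, so an offset at the
start reappears at the end. This lets the evaluation of the remaining rounds, which starts at time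
zero, be attached to a first round. -/
theorem fix_loopStep_add {F G : Data →. Data × ℕ} {x z : Data} {u v : ℕ} (w : ℕ)
    (h : (z, u) ∈ PFun.fix (Prog.loopStep F G) (x, v)) :
    (z, w + u) ∈ PFun.fix (Prog.loopStep F G) (x, w + v) := by
  have key : ∀ s : Data × ℕ, (z, u) ∈ PFun.fix (Prog.loopStep F G) s →
      (z, w + u) ∈ PFun.fix (Prog.loopStep F G) (s.1, w + s.2) := by
    intro s hs
    refine PFun.fixInduction' hs ?_ ?_
    · intro s hs
      refine PFun.fix_stop ?_
      simp only [Prog.loopStep, Part.mem_bind_iff] at hs ⊢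
      obtain ⟨a, ha, hs⟩ := hs
      refine ⟨a, ha, ?_⟩
      cases hd : decide (a.1.size = 1)
      · simp [hd] at hs
      · simp only [hd, cond_true, Part.mem_some_iff, Sum.inl.injEq, Prod.mk.injEq] at hs ⊢
        exact ⟨hs.1, by omega⟩
    · intro s s' _ hs ih
      refine PFun.mem_fix_iff.2 (Or.inr ⟨_, ?_, ih⟩)
      simp only [Prog.loopStep, Part.mem_bind_iff] at hs ⊢
      obtain ⟨a, ha, hs⟩ := hs
      refine ⟨a, ha, ?_⟩
      cases hd : decide (a.1.size = 1)
      · simp only [hd, cond_false, Part.mem_bind_iff] at hs ⊢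
        obtain ⟨b, hb, hs⟩ := hs
        refine ⟨b, hb, ?_⟩
        simp only [Part.mem_some_iff, Sum.inr.injEq] at hs ⊢
        subst hs
        simp only [Prod.mk.injEq, true_and]
        omega
      · simp [hd] at hs
  exact key (x, v) h

theorem Prog.mem_eval_loop_stop {p q : Prog} {x : Data} {s : ℕ} (hp : (.nil, s) ∈ p.eval x) :
    (x, s + x.size) ∈ (Prog.loop p q).eval x := by
  refine PFun.fix_stop ?_
  simp only [Prog.loopStep, Part.mem_bind_iff]
  exact ⟨_, hp, by simp [Data.size]⟩

theorem Prog.mem_eval_loop_step {p q : Prog} {x a b y z : Data} {s t u : ℕ}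
    (hp : (.cons a b, s) ∈ p.eval x) (hq : (y, t) ∈ q.eval x)
    (hl : (z, u) ∈ (Prog.loop p q).eval y) :
    (z, s + t + u + x.size) ∈ (Prog.loop p q).eval x := by
  have h := fix_loopStep_add (s + t + x.size) hl
  refine PFun.mem_fix_iff.2 (Or.inr ⟨(y, s + t + x.size), ?_, ?_⟩)
  · simp only [Prog.loopStep, Part.mem_bind_iff]
    exact ⟨_, hp, by
      rw [decide_size_cons, cond_false, Part.mem_bind_iff]
      exact ⟨_, hq, by simp⟩⟩
  · rw [show s + t + u + x.size = s + t + x.size + u by omega]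
    simpa using h

/-- A partial function has at most one value, so this direction suffices: whenever a run exists,
`Prog.eval` returns its output and time. -/
theorem Runs.mem_eval {p : Prog} {x y : Data} {t : ℕ} (h : Runs p x y t) :
    (y, t) ∈ p.eval x := by
  induction h with
  | nil x => simp [Prog.eval]
  | id x => simp [Prog.eval]
  | fst x => simp [Prog.eval]
  | snd x => simp [Prog.eval]
  | pair _ _ hp hq =>
    simp only [Prog.eval, Part.mem_bind_iff]
    exact ⟨_, hp, _, hq, Part.mem_some _⟩
  | comp _ _ hp hq =>
    simp only [Prog.eval, Part.mem_bind_iff]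
    exact ⟨_, hp, _, hq, Part.mem_some _⟩
  | cond_true _ _ hp hq =>
    simp only [Prog.eval, Part.mem_bind_iff]
    exact ⟨_, hp, _, by rw [decide_size_cons]; exact hq, Part.mem_some _⟩
  | cond_false _ _ hp hr =>
    simp only [Prog.eval, Part.mem_bind_iff]
    exact ⟨_, hp, _, by simpa [Data.size] using hr, Part.mem_some _⟩
  | loop_stop _ hp =>
    refine Prog.mem_eval_loop_stop hp
  | @loop_step p q x a b y z s t u _ _ _ hp hq hl =>
    exact Prog.mem_eval_loop_step hp hq hl

/-! ### Partial recursive functions are computed by programs -/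

namespace Data

/-- Unary encoding of a natural number. -/
def unary : ℕ → Data
  | 0 => nil
  | n + 1 => cons nil (unary n)

@[simp] theorem size_unary (n : ℕ) : (unary n).size = 2 * n + 1 := by
  induction n with
  | zero => rfl
  | succ n ih => simp only [unary, size, ih]; omega

@[simp] theorem length_toL_unary (n : ℕ) : (unary n).toL.length = n := by
  induction n with
  | zero => rfl
  | succ n ih => simp [unary, ih]

theorem primrec_unary : Primrec unary := by
  refine (Primrec.nat_rec₁ nil (primrec_cons.comp (.const nil) .snd).to₂).of_eq fun n => ?_
  induction n with
  | zero => rfl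
  | succ n ih => simp only [unary, ← ih]

theorem fst_ofList_unary (v : List ℕ) : (ofList unary v).fst = unary v.headI := by
  cases v <;> rfl

theorem snd_ofList_unary (v : List ℕ) : (ofList unary v).snd = ofList unary v.tail := by
  cases v <;> rfl

end Data

open Turing.ToPartrec in
/-- Translation of codes for operations on lists of numbers. -/
def Prog.ofCode : Code → Prog
  | .zero' => .pair .nil .id
  | .succ => .pair (.pair .nil .fst) .nil
  | .tail => .snd
  | .cons f g => .pair (.comp (ofCode f) .fst) (ofCode g)
  | .comp f g => .comp (ofCode g) (ofCode f)
  | .case f g => .cond .fst (.comp (.pair (.comp .fst .snd) .snd) (ofCode g))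
      (.comp .snd (ofCode f))
  | .fix f => .comp (ofCode f) (.comp (.loop .fst (.comp .snd (ofCode f))) .snd)

/-- `p` halts on `x` with the output `y`. -/
def Halts (p : Prog) (x y : Data) : Prop := ∃ t, Runs p x y t

namespace Halts

variable {p q r : Prog} {x y z a b : Data}

theorem nil : Halts .nil x .nil := ⟨_, .nil x⟩
theorem id : Halts .id x x := ⟨_, .id x⟩
theorem fst : Halts .fst x x.fst := ⟨_, .fst x⟩
theorem snd : Halts .snd x x.snd := ⟨_, .snd x⟩
theorem pair : Halts p x a → Halts q x b → Halts (.pair p q) x (.cons a b)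
  | ⟨_, h⟩, ⟨_, h'⟩ => ⟨_, .pair h h'⟩
theorem comp : Halts p x y → Halts q y z → Halts (.comp p q) x z
  | ⟨_, h⟩, ⟨_, h'⟩ => ⟨_, .comp h h'⟩
theorem cond_true : Halts p x (.cons a b) → Halts q x y → Halts (.cond p q r) x y
  | ⟨_, h⟩, ⟨_, h'⟩ => ⟨_, .cond_true h h'⟩
theorem cond_false : Halts p x .nil → Halts r x y → Halts (.cond p q r) x y
  | ⟨_, h⟩, ⟨_, h'⟩ => ⟨_, .cond_false h h'⟩
theorem loop_exit : Halts p x .nil → Halts (.loop p q) x x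
  | ⟨_, h⟩ => ⟨_, Runs.loop_stop h⟩
theorem loop_step : Halts p x (.cons a b) → Halts q x y → Halts (.loop p q) y z →
    Halts (.loop p q) x z
  | ⟨_, h⟩, ⟨_, h'⟩, ⟨_, h''⟩ => ⟨_, .loop_step h h' h''⟩

end Halts

open Turing.ToPartrec Data in
-- In unary, the successor, the predecessor and the test for zero are elementary operations on
-- trees. Only termination is claimed; the time is measured afterwards.
theorem halts_ofCode (c : Code) : ∀ v w : List ℕ, w ∈ c.eval v →
    Halts (.ofCode c) (ofList unary v) (ofList unary w) := by
  induction c with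
  | zero' =>
    intro v w h
    simp only [Code.zero'_eval, Part.pure_eq_some, Part.mem_some_iff] at h
    subst h
    exact .pair .nil .id
  | succ =>
    intro v w h
    simp only [Code.succ_eval, Part.pure_eq_some, Part.mem_some_iff] at h
    subst h
    simp only [ofList, unary, ← fst_ofList_unary]
    exact .pair (.pair .nil .fst) .nil
  | tail =>
    intro v w h
    simp only [Code.tail_eval, Part.pure_eq_some, Part.mem_some_iff] at h
    subst h
    rw [← snd_ofList_unary]
    exact .snd
  | cons f g hf hg =>
    intro v w h
    simp only [Code.cons_eval, Part.bind_eq_bind, Part.mem_bind_iff, Part.pure_eq_some,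
      Part.mem_some_iff] at h
    obtain ⟨a, ha, b, hb, rfl⟩ := h
    simp only [ofList, ← fst_ofList_unary]
    exact .pair (.comp (hf _ _ ha) .fst) (hg _ _ hb)
  | comp f g hf hg =>
    intro v w h
    rw [Code.comp_eval] at h
    obtain ⟨a, ha, hb⟩ := Part.mem_bind_iff.1 h
    exact .comp (hg _ _ ha) (hf _ _ hb)
  | case f g hf hg =>
    intro v w h
    simp only [Code.case_eval] at h
    rcases hv : v.headI with _ | n <;> rw [hv] at h
    · refine .cond_false ?_ (.comp ?_ (hf _ _ h))
      · simpa [fst_ofList_unary, hv, unary] using Halts.fst (x := ofList unary v)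
      · rw [← snd_ofList_unary]; exact .snd
    · have h1 : Halts .fst (ofList unary v) (.cons .nil (unary n)) := by
        simpa [fst_ofList_unary, hv, unary] using Halts.fst (x := ofList unary v)
      refine .cond_true h1 (.comp (.pair (.comp h1 .snd) .snd) ?_)
      rw [snd_ofList_unary]
      exact hg _ _ h
  | fix f hf =>
    intro v w h
    -- `Code.fix f` always runs `f` once before its first test. The loop state is thus the latest
    -- output of `f`: its head is tested, and its tail is either the next input or the result.
    have key : ∀ v, w ∈ (Code.fix f).eval v → ∃ u u', Halts (.ofCode f) (ofList unary v) u ∧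
        Halts (.loop .fst (.comp .snd (.ofCode f))) u u' ∧ u'.snd = ofList unary w := by
      intro v h
      rw [Code.fix_eval] at h
      refine PFun.fixInduction' (C := fun v => ∃ u u', Halts (.ofCode f) (ofList unary v) u ∧
        Halts (.loop .fst (.comp .snd (.ofCode f))) u u' ∧ u'.snd = ofList unary w) h ?_ ?_
      · intro v hv
        obtain ⟨u, hu, h1⟩ := (Part.mem_map_iff _).1 hv
        have h2 : u.headI = 0 ∧ u.tail = w := by
          split_ifs at h1 with h3
          exact ⟨h3, by simpa using h1⟩
        refine ⟨_, _, hf _ _ hu, .loop_exit ?_, by rw [snd_ofList_unary, h2.2]⟩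
        simpa [fst_ofList_unary, h2.1, unary] using Halts.fst (x := ofList unary u)
      · rintro v v' - hv ⟨u', u'', h3, h4, h5⟩
        obtain ⟨u, hu, h1⟩ := (Part.mem_map_iff _).1 hv
        have h2 : u.headI ≠ 0 ∧ u.tail = v' := by
          split_ifs at h1 with h3
          exact ⟨h3, by simpa using h1⟩
        obtain ⟨n, hn⟩ := Nat.exists_eq_succ_of_ne_zero h2.1
        refine ⟨_, _, hf _ _ hu, .loop_step (a := .nil) (b := unary n) ?_ (.comp .snd ?_) h4, h5⟩
        · simpa [fst_ofList_unary, hn, unary] using Halts.fst (x := ofList unary u)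
        · rwa [snd_ofList_unary, h2.2]
    obtain ⟨u, u', h1, h2, h3⟩ := key v h
    exact .comp h1 (.comp h2 (h3 ▸ .snd))

theorem exists_prog_of_computable₂ {G : ℕ → ℕ → ℕ} (hG : Computable₂ G) :
    ∃ p : Prog, ∀ k j, Halts p (.cons (.unary k) (.cons (.unary j) .nil)) (.unary (G k j)) := by
  have h : Partrec₂ fun k j => (Part.some (G k j)) := hG.partrec₂
  obtain ⟨c, hc⟩ := Turing.ToPartrec.Code.exists_code (Nat.Partrec'.part_iff₂.2 h)
  refine ⟨.comp (.ofCode c) .fst, fun k j => ?_⟩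
  have := halts_ofCode c [k, j] [G k j] (by
    have := hc ⟨[k, j], rfl⟩
    simp only at this
    rw [this]
    simp [List.Vector.head, List.Vector.tail])
  exact .comp this .fst

namespace Data

/-- The instructions that build a tree on a stack: `1` pushes `nil`, and `2` replaces the two
topmost trees by their pair. -/
def instructions : Data → List ℕ
  | nil => [1]
  | cons a b => a.instructions ++ (b.instructions ++ [2])

theorem primrec_instructions : Primrec instructions :=
  primrec_rec (fun a b => a ++ (b ++ [2])) (Primrec.list_append.comp .fst
    (Primrec.list_append.comp .snd (.const [2]))) fun _ _ => rfl

/-- Execution of one instruction. -/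
def exec (s : Data) (n : ℕ) : Data :=
  if n = 2 then cons (cons s.snd.fst s.fst) s.snd.snd else cons nil s

theorem foldl_exec (d s : Data) : d.instructions.foldl exec s = cons d s := by
  induction d generalizing s with
  | nil => rfl
  | cons a b ha hb => simp [instructions, ha, hb, exec]

theorem mem_instructions {d : Data} {n : ℕ} (h : n ∈ d.instructions) : n = 1 ∨ n = 2 := by
  induction d with
  | nil => simp_all [instructions]
  | cons a b ha hb =>
    simp only [instructions, List.mem_append, List.mem_singleton] at h
    tauto

end Data

open Data in
-- Translated codes return numbers, not trees. The program therefore asks for the instructions that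
-- build the tree one at a time and executes them on a stack. The default `0` of `getD` marks the
-- end and stops the loop, since genuine instructions are nonzero.
theorem exists_prog_of_computable {E : ℕ → Data} (hE : Computable E) :
    ∃ p : Prog, ∀ k, Halts p (.unary k) (E k) := by
  obtain ⟨g, hg⟩ := exists_prog_of_computable₂ (G := fun k j => (E k).instructions.getD j 0)
    ((Primrec.list_getD 0).to_comp.comp (primrec_instructions.to_comp.comp
      (hE.comp Computable.fst)) Computable.snd)
  let test : Prog := .comp (.pair .fst (.pair (.comp .snd .fst) .nil)) g
  let stack : Prog := .comp .snd .snd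
  -- Of the two instructions, only `2` has a unary code with a nonempty tail, which is what the
  -- inner condition tests. Prefixing `nil` increments the unary position.
  let step : Prog := .pair .fst (.pair (.pair .nil (.comp .snd .fst)) (.cond (.comp test .snd)
    (.pair (.pair (.comp stack (.comp .snd .fst)) (.comp stack .fst)) (.comp stack (.comp .snd .snd)))
    (.pair .nil stack)))
  have hstack : ∀ a b c, Halts stack (.cons a (.cons b c)) c := fun a b c => .comp .snd .snd
  have htest : ∀ k j s, Halts test (.cons (unary k) (.cons (unary j) s))
      (unary ((E k).instructions.getD j 0)) := fun k j s =>
    .comp (.pair .fst (.pair (.comp .snd .fst) .nil)) (hg k j)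
  have hstep : ∀ k j s, Halts step (.cons (unary k) (.cons (unary j) s))
      (.cons (unary k) (.cons (unary (j + 1)) (if ((E k).instructions.getD j 0) ≤ 1
        then .cons .nil s else .cons (.cons s.snd.fst s.fst) s.snd.snd))) := by
    intro k j s
    refine .pair .fst (.pair (.pair .nil (.comp .snd .fst)) ?_)
    have h1 := htest k j s
    generalize (E k).instructions.getD j 0 = n at h1
    rcases n with _ | _ | n
    · exact .cond_false (.comp h1 .snd) (.pair .nil (hstack _ _ _))
    · exact .cond_false (.comp h1 .snd) (.pair .nil (hstack _ _ _))
    · rw [if_neg (by omega)]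
      exact .cond_true (.comp h1 .snd) (.pair (.pair (.comp (hstack _ _ _) (.comp .snd .fst))
        (.comp (hstack _ _ _) .fst)) (.comp (hstack _ _ _) (.comp .snd .snd)))
  refine ⟨.comp (.pair .id (.pair .nil .nil)) (.comp (.loop test step) (.comp stack .fst)),
    fun k => .comp (.pair .id (.pair .nil .nil)) ?_⟩
  have key : ∀ l₁ l₂, (E k).instructions = l₁ ++ l₂ → ∀ s, Halts (.loop test step)
      (.cons (unary k) (.cons (unary l₁.length) s))
      (.cons (unary k) (.cons (unary (l₁ ++ l₂).length) (l₂.foldl exec s))) := by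
    intro l₁ l₂
    induction l₂ generalizing l₁ with
    | nil =>
      intro h s
      rw [List.append_nil]
      refine .loop_exit ?_
      have := htest k l₁.length s
      rwa [h, List.getD_eq_default _ _ (by simp)] at this
    | cons n l₂ ih =>
      intro h s
      have h1 := htest k l₁.length s
      have h2 := hstep k l₁.length s
      rw [h, List.getD_append_right _ _ _ _ le_rfl] at h1 h2
      have h3 := ih (l₁ ++ [n]) (by simp [h])
      have hn := mem_instructions (d := E k) (n := n) (by simp [h])
      simp only [Nat.sub_self, List.getD_cons_zero] at h1 h2
      simp only [List.append_assoc, List.singleton_append, List.length_append, List.length_cons,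
        List.length_nil, List.foldl_cons] at h3 ⊢
      rcases hn with rfl | rfl
      · exact .loop_step h1 h2 (h3 _)
      · exact .loop_step h1 h2 (h3 _)
  have h := key [] _ rfl .nil
  rw [foldl_exec] at h
  exact .comp h (.comp (hstack _ _ _) .fst)

/-! ### Models of hypergraphs -/

/-- `S` is a model of the edge set `F` in the edge set `E`: it sends the vertices of `E` to sets
of vertices of `F` such that every edge of `E` is sent into an edge of `F`, every edge of `F` is
the image of an edge of `E`, and the vertices whose image contains a given vertex are connected:
a property which passes along the edges between such vertices holds for all of them or for none. -/
structure IsModel (E F : Finset (Finset ℕ)) (S : ℕ → Finset ℕ) : Prop where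
  sub : ∀ e ∈ E, ∃ f ∈ F, ∀ v ∈ e, S v ⊆ f
  cover : ∀ f ∈ F, ∃ e ∈ E, e.biUnion S = f
  conn : ∀ (u : ℕ) (A : ℕ → Prop),
    (∀ e ∈ E, ∀ v ∈ e, ∀ v' ∈ e, u ∈ S v → u ∈ S v' → A v → A v') →
    ∀ e ∈ E, ∀ v ∈ e, ∀ e' ∈ E, ∀ v' ∈ e', u ∈ S v → u ∈ S v' → A v → A v'

namespace IsModel

variable {E F G : Finset (Finset ℕ)} {S T : ℕ → Finset ℕ}

/-- For connectivity, a move inside an edge `f` of `F` is lifted to an edge of `E` with image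
exactly `f`; changes between vertices over the same `w` are handled by the connectivity of `S`. -/
theorem trans (hS : IsModel E F S) (hT : IsModel F G T) :
    IsModel E G fun v => (S v).biUnion T where
  sub e he := by
    obtain ⟨f, hf, h⟩ := hS.sub e he
    obtain ⟨g, hg, h'⟩ := hT.sub f hf
    exact ⟨g, hg, fun v hv => Finset.biUnion_subset.2 fun w hw => h' w (h v hv hw)⟩
  cover g hg := by
    obtain ⟨f, hf, rfl⟩ := hT.cover g hg
    obtain ⟨e, he, rfl⟩ := hS.cover f hf
    exact ⟨e, he, (Finset.biUnion_biUnion ..).symm⟩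
  conn u A hA e he v hv e' he' v' hv' hu hu' hAv := by
    obtain ⟨w, hw, hwu⟩ := Finset.mem_biUnion.1 hu
    obtain ⟨w', hw', hwu'⟩ := Finset.mem_biUnion.1 hu'
    have key : ∀ w, u ∈ T w → ∀ e ∈ E, ∀ v ∈ e, ∀ e' ∈ E, ∀ v' ∈ e', w ∈ S v → w ∈ S v' →
        A v → A v' := fun w hwu =>
      hS.conn w A fun e he v hv v' hv' h h' =>
        hA e he v hv v' hv' (Finset.mem_biUnion.2 ⟨w, h, hwu⟩) (Finset.mem_biUnion.2 ⟨w, h', hwu⟩)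
    obtain ⟨f, hf, hfe⟩ := hS.sub e he
    obtain ⟨f', hf', hfe'⟩ := hS.sub e' he'
    -- The property carried along `F` is that all vertices over `w` satisfy `A`.
    refine hT.conn u (fun w => ∀ e ∈ E, ∀ v ∈ e, w ∈ S v → A v) ?_ f hf w (hfe v hv hw) f' hf' w'
      (hfe' v' hv' hw') hwu hwu' (fun e₁ he₁ v₁ hv₁ h₁ => key w hwu e he v hv e₁ he₁ v₁ hv₁ hw h₁
        hAv) e' he' v' hv' hw'
    intro f hf w hw w' hw' hwu hwu' hall e₁ he₁ v₁ hv₁ h₁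
    obtain ⟨e₂, he₂, rfl⟩ := hS.cover f hf
    obtain ⟨v₂, hv₂, hw₂⟩ := Finset.mem_biUnion.1 hw
    obtain ⟨v₃, hv₃, hw₃⟩ := Finset.mem_biUnion.1 hw'
    have := hA e₂ he₂ v₂ hv₂ v₃ hv₃ (Finset.mem_biUnion.2 ⟨w, hw₂, hwu⟩)
      (Finset.mem_biUnion.2 ⟨w', hw₃, hwu'⟩) (hall e₂ he₂ v₂ hv₂ hw₂)
    exact key w' hwu' e₂ he₂ v₃ hv₃ e₁ he₁ v₁ hv₁ hw₃ h₁ this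

/-- A model in which all images are singletons or empty and no two vertices have a common
image. -/
theorem of_subsingleton (h : ∀ e ∈ E, ∃ f ∈ F, ∀ v ∈ e, S v ⊆ f)
    (h' : ∀ f ∈ F, ∃ e ∈ E, e.biUnion S = f)
    (hS : ∀ e ∈ E, ∀ v ∈ e, ∀ e' ∈ E, ∀ v' ∈ e', ∀ u, u ∈ S v → u ∈ S v' → v = v') :
    IsModel E F S where
  sub := h
  cover := h'
  conn u _ _ e he v hv e' he' v' hv' hu hu' hA := hS e he v hv e' he' v' hv' u hu hu' ▸ by assumption

end IsModel

namespace Hypergraph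

variable {H K M : Hypergraph}

theorem Iso.exists_isModel (h : Iso H K) : ∃ S, IsModel H.edges K.edges S := by
  obtain ⟨φ, hφ, -, he⟩ := h
  refine ⟨fun v => {φ v}, .of_subsingleton ?_ ?_ ?_⟩
  · intro e h
    refine ⟨e.image φ, he ▸ Finset.mem_image_of_mem _ h, fun v hv => ?_⟩
    simpa using ⟨v, hv, rfl⟩
  · intro f hf
    rw [← he] at hf
    obtain ⟨e, h, rfl⟩ := Finset.mem_image.1 hf
    refine ⟨e, h, ?_⟩
    rw [Finset.biUnion_singleton]
  · intro e he v hv e' he' v' hv' u hu hu'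
    rw [Finset.mem_singleton] at hu hu'
    exact hφ (H.edges_subset e he hv) (H.edges_subset e' he' hv') (hu ▸ hu')

theorem exists_isModel_deleteVertex (H : Hypergraph) (v : ℕ) :
    ∃ S, IsModel H.edges (H.deleteVertex v).edges S := by
  have hbi : ∀ e : Finset ℕ, (e.biUnion fun u => if u = v then ∅ else {u}) = e.erase v := by
    intro e
    ext x
    simp only [Finset.mem_biUnion, Finset.mem_erase]
    constructor
    · rintro ⟨a, ha, hx⟩
      split_ifs at hx with h
      · simp at hx
      · rw [Finset.mem_singleton] at hx
        subst hx
        exact ⟨h, ha⟩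
    · rintro ⟨hx, hxe⟩
      exact ⟨x, hxe, by simp [hx]⟩
  refine ⟨fun u => if u = v then ∅ else {u}, .of_subsingleton ?_ ?_ ?_⟩
  · intro e he
    refine ⟨e.erase v, Finset.mem_image_of_mem _ he, fun u hu => ?_⟩
    rw [← hbi]
    exact Finset.subset_biUnion_of_mem (fun u => if u = v then ∅ else {u}) hu
  · intro f hf
    obtain ⟨e, he, rfl⟩ := Finset.mem_image.1 hf
    exact ⟨e, he, hbi e⟩
  · intro e _ u _ e' _ u' _ x hx hx'
    split_ifs at hx hx' <;> simp_all

/-- The identity works because the deleted edge lies in `e'`. This is the reason why a model sends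
edges into edges and not onto them. -/
theorem exists_isModel_deleteEdge {e e' : Finset ℕ} (he' : e' ∈ H.edges) (h : e ⊂ e') :
    ∃ S, IsModel H.edges (H.deleteEdge e).edges S := by
  refine ⟨fun v => {v}, .of_subsingleton ?_ ?_ ?_⟩
  · intro f hf
    by_cases hfe : f = e
    · refine ⟨e', Finset.mem_erase.2 ⟨h.ne', he'⟩, fun v hv => ?_⟩
      simpa using h.subset (hfe ▸ hv)
    · exact ⟨f, Finset.mem_erase.2 ⟨hfe, hf⟩, fun v hv => by simpa using hv⟩
  · intro f hf
    exact ⟨f, Finset.mem_of_mem_erase hf, by simp⟩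
  · intro e _ u _ e' _ u' _ x hx hx'
    simp_all

/-- Since `v` receives the whole merged edge, any single edge through `v` already covers it. Such an
edge exists by `H.NoIsolated`; merging on an isolated vertex would create an empty edge out of
nothing. A vertex `u` of the merged edge lies only in the images of `v` and of `u` itself, and these
two share an edge. -/
theorem exists_isModel_merge (hH : H.NoIsolated) {v : ℕ} (hv : v ∈ H.verts) :
    ∃ S, IsModel H.edges (H.merge v).edges S := by
  set e₀ := ((H.incident v).biUnion _root_.id).erase v with he₀
  have hmem : ∀ e ∈ H.edges, v ∈ e → ∀ u ∈ e, u ≠ v → u ∈ e₀ := fun e he hve u hu hne =>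
    Finset.mem_erase.2 ⟨hne, Finset.mem_biUnion.2 ⟨e, Finset.mem_filter.2 ⟨he, hve⟩, hu⟩⟩
  have hnot : ∀ e ∈ H.edges, v ∉ e → e ∈ (H.merge v).edges := fun e he hve =>
    Finset.mem_insert_of_mem (Finset.mem_sdiff.2 ⟨he, fun h => hve (Finset.mem_filter.1 h).2⟩)
  have hS : ∀ e : Finset ℕ, v ∉ e → ∀ u ∈ e, (if u = v then e₀ else {u}) = {u} :=
    fun e he u hu => if_neg (by rintro rfl; exact he hu)
  refine ⟨fun u => if u = v then e₀ else {u}, ?_, ?_, ?_⟩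
  · intro e he
    by_cases hve : v ∈ e
    · refine ⟨e₀, Finset.mem_insert_self _ _, fun u hu => ?_⟩
      split_ifs with h
      · exact le_rfl
      · exact Finset.singleton_subset_iff.2 (hmem e he hve u hu h)
    · refine ⟨e, hnot e he hve, fun u hu => ?_⟩
      rw [hS e hve u hu]
      simpa using hu
  · intro f hf
    rcases Finset.mem_insert.1 hf with rfl | hf
    · obtain ⟨e, he, hve⟩ := hH v hv
      refine ⟨e, he, subset_antisymm (Finset.biUnion_subset.2 fun u hu => ?_) ?_⟩
      · split_ifs with h
        · exact le_rfl
        · exact Finset.singleton_subset_iff.2 (hmem e he hve u hu h)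
      · intro x hx
        exact Finset.mem_biUnion.2 ⟨v, hve, by rw [if_pos rfl]; exact hx⟩
    · obtain ⟨hf, hf'⟩ := Finset.mem_sdiff.1 hf
      have hvf : v ∉ f := fun h => hf' (Finset.mem_filter.2 ⟨hf, h⟩)
      refine ⟨f, hf, ?_⟩
      rw [Finset.biUnion_congr rfl (hS f hvf)]
      simp
  · intro u A hA e he w hw e' he' w' hw' hu hu' hAw
    have key : ∀ w, u ∈ (if w = v then e₀ else {w}) → (w = v ∧ u ∈ e₀) ∨ w = u := by
      intro w h
      split_ifs at h with h1
      · exact Or.inl ⟨h1, h⟩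
      · exact Or.inr (Finset.mem_singleton.1 h).symm
    have hedge : u ∈ e₀ → ∃ e ∈ H.edges, v ∈ e ∧ u ∈ e ∧ u ≠ v := by
      intro h
      obtain ⟨h1, h2⟩ := Finset.mem_erase.1 h
      obtain ⟨e, he, hue⟩ := Finset.mem_biUnion.1 h2
      exact ⟨e, (Finset.mem_filter.1 he).1, (Finset.mem_filter.1 he).2, hue, h1⟩
    rcases key w hu with ⟨rfl, h1⟩ | rfl <;> rcases key w' hu' with ⟨rfl, h2⟩ | rfl
    · exact hAw
    · obtain ⟨f, hf, h3, h4, h5⟩ := hedge h1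
      exact hA f hf w h3 w' h4 (by simpa using h1) (by simp [h5]) hAw
    · obtain ⟨f, hf, h3, h4, h5⟩ := hedge h2
      exact hA f hf w h4 w' h3 (by simp [h5]) (by simpa using h2) hAw
    · exact hAw

theorem Step.noIsolated (h : Step H K) (hH : H.NoIsolated) : K.NoIsolated := by
  cases h with
  | deleteVertex v hv =>
    intro u hu
    obtain ⟨h1, h2⟩ := Finset.mem_erase.1 hu
    obtain ⟨e, he, hue⟩ := hH u h2
    exact ⟨e.erase v, Finset.mem_image_of_mem _ he, Finset.mem_erase.2 ⟨h1, hue⟩⟩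
  | deleteEdge e e' he he' h =>
    intro u hu
    obtain ⟨f, hf, huf⟩ := hH u hu
    by_cases hfe : f = e
    · exact ⟨e', Finset.mem_erase.2 ⟨h.ne', he'⟩, h.subset (hfe ▸ huf)⟩
    · exact ⟨f, Finset.mem_erase.2 ⟨hfe, hf⟩, huf⟩
  | merge v hv =>
    intro u hu
    obtain ⟨h1, h2⟩ := Finset.mem_erase.1 hu
    obtain ⟨e, he, hue⟩ := hH u h2
    by_cases hve : v ∈ e
    · exact ⟨_, Finset.mem_insert_self _ _, Finset.mem_erase.2 ⟨h1,
        Finset.mem_biUnion.2 ⟨e, Finset.mem_filter.2 ⟨he, hve⟩, hue⟩⟩⟩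
    · exact ⟨e, Finset.mem_insert_of_mem (Finset.mem_sdiff.2
        ⟨he, fun h => hve (Finset.mem_filter.1 h).2⟩), hue⟩

theorem Step.exists_isModel (h : Step H K) (hH : H.NoIsolated) :
    ∃ S, IsModel H.edges K.edges S := by
  cases h with
  | deleteVertex v hv => exact H.exists_isModel_deleteVertex v
  | deleteEdge e e' he he' h => exact exists_isModel_deleteEdge he' h
  | merge v hv => exact exists_isModel_merge hH hv

theorem IsDilutionOf.exists_isModel (h : M.IsDilutionOf H) (hH : H.NoIsolated) :
    ∃ S, IsModel H.edges M.edges S := by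
  obtain ⟨K, hK, hiso⟩ := h
  suffices h : ∃ S, IsModel H.edges K.edges S by
    obtain ⟨S, hS⟩ := h
    obtain ⟨T, hT⟩ := hiso.exists_isModel
    exact ⟨_, hS.trans hT⟩
  suffices h : K.NoIsolated ∧ ∃ S, IsModel H.edges K.edges S from h.2
  clear hiso
  induction hK with
  | refl =>
    refine ⟨hH, fun v => {v}, .of_subsingleton ?_ ?_ ?_⟩
    · exact fun e he => ⟨e, he, fun v hv => by simpa using hv⟩
    · exact fun e he => ⟨e, he, by simp⟩
    · intro e _ u _ e' _ u' _ x hx hx'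
      simp_all
  | tail _ hs ih =>
    obtain ⟨h1, S, hS⟩ := ih
    obtain ⟨T, hT⟩ := hs.exists_isModel h1
    exact ⟨hs.noIsolated h1, _, hS.trans hT⟩

end Hypergraph

/-! ### Transfer of solutions along a model -/

/-- The assignment that gives the entries of the first list the values at the same positions of
the second list. -/
def assign : List ℕ → List ℕ → ℕ → ℕ
  | [], _, _ => 0
  | a :: l, ds, x => if a = x then ds.headI else assign l ds.tail x

theorem assign_map (μ : ℕ → ℕ) {l : List ℕ} {x : ℕ} (hx : x ∈ l) :
    assign l (l.map μ) x = μ x := by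
  induction l with
  | nil => simp at hx
  | cons a l ih =>
    by_cases h : a = x
    · simp [assign, h]
    · have : x ∈ l := by simpa [Ne.symm h] using hx
      simpa [assign, h] using ih this

/-- The atom `a₀` of `q` and the fact `d` induce an assignment that respects `q` and covers the
atom `a`. -/
def Compatible (q : Query) (D : Database) (S : ℕ → List ℕ) (a a₀ d : Atom) : Prop :=
  (∀ v ∈ a.args, ∀ x ∈ S v, x ∈ a₀.args) ∧
  ∀ b ∈ q, (∀ x ∈ b.args, x ∈ a₀.args) →
    (⟨b.symbol, b.args.map (assign a₀.args d.args)⟩ : Atom) ∈ D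

/-- The fact for the atom `a` in which a variable `v` has the code of the values of the
variables in `S v`. -/
def codedFact (code : List ℕ → ℕ) (S : ℕ → List ℕ) (a a₀ d : Atom) : Atom :=
  ⟨a.symbol, a.args.map fun v => code ((S v).map (assign a₀.args d.args))⟩

theorem Query.mem_vars {q : Query} {x : ℕ} : x ∈ q.vars ↔ ∃ a ∈ q, x ∈ a.args := by
  simp [Query.vars]

theorem Query.mem_edges {q : Query} {e : Finset ℕ} :
    e ∈ q.hypergraph.edges ↔ ∃ a ∈ q, a.args.toFinset = e := by
  simp [Query.hypergraph]

/-- An assignment of the variables of a query, extended by zero. -/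
def extend {V : Finset ℕ} (ν : V → ℕ) (x : ℕ) : ℕ := if h : x ∈ V then ν ⟨x, h⟩ else 0

theorem mem_solutions_iff {q : Query} {D : Database} {ν : Query.vars q → ℕ} :
    ν ∈ q.solutions D ↔ ∀ a ∈ q, (⟨a.symbol, a.args.map (extend ν)⟩ : Atom) ∈ D := by
  have hext : ∀ x : Query.vars q, extend ν x = ν x := fun x => by simp [extend]
  refine ⟨fun ⟨μ, h1, h2⟩ a ha => ?_, fun h => ⟨extend ν, hext, h⟩⟩
  have : a.args.map (extend ν) = a.args.map μ := List.map_congr_left fun x hx => by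
    have hx' : x ∈ q.vars := Query.mem_vars.2 ⟨a, ha, hx⟩
    rw [hext ⟨x, hx'⟩, ← h1]
  rw [this]
  exact h2 a ha

/-- The bijection sends `ν` to the codes of its restrictions to the lists `S v`. It is injective
because every variable of `q` occurs in some `S v`. For surjectivity, each atom of `p` provides a
local assignment; `IsModel.conn` glues these, and `IsModel.cover` places each atom of `q` within the
reach of one of them. -/
theorem ncard_solutions_eq {p q : Query} {D D' : Database} {S : ℕ → List ℕ}
    {code : List ℕ → ℕ} (hcode : Function.Injective code)
    (hp : ∀ a ∈ p, ∀ b ∈ p, a.symbol = b.symbol → a = b)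
    (hD : ∀ f, f ∈ D' ↔ ∃ a ∈ p, ∃ a₀ ∈ q, ∃ d ∈ D, Compatible q D S a a₀ d ∧
      f = codedFact code S a a₀ d)
    (hS : IsModel p.hypergraph.edges q.hypergraph.edges fun v => (S v).toFinset) :
    (p.solutions D').ncard = (q.solutions D).ncard := by
  have hsub : ∀ a ∈ p, ∃ a₀ ∈ q, ∀ v ∈ a.args, ∀ x ∈ S v, x ∈ a₀.args := by
    intro a ha
    obtain ⟨f, hf, h⟩ := hS.sub _ (Query.mem_edges.2 ⟨a, ha, rfl⟩)
    obtain ⟨a₀, ha₀, rfl⟩ := Query.mem_edges.1 hf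
    exact ⟨a₀, ha₀, fun v hv x hx => by simpa using h v (by simpa using hv) (by simpa using hx)⟩
  have hcover : ∀ b ∈ q, ∃ a ∈ p, ∀ x, x ∈ b.args ↔ ∃ v ∈ a.args, x ∈ S v := by
    intro b hb
    obtain ⟨e, he, h⟩ := hS.cover _ (Query.mem_edges.2 ⟨b, hb, rfl⟩)
    obtain ⟨a, ha, rfl⟩ := Query.mem_edges.1 he
    exact ⟨a, ha, fun x => by simpa using (Finset.ext_iff.1 h x).symm⟩
  symm
  refine Set.ncard_congr (fun ν _ v => code ((S v).map (extend ν))) ?_ ?_ ?_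
  · intro ν hν
    rw [mem_solutions_iff] at hν ⊢
    intro a ha
    obtain ⟨a₀, ha₀, h⟩ := hsub a ha
    have hassign : ∀ x ∈ a₀.args, assign a₀.args (a₀.args.map (extend ν)) x = extend ν x :=
      fun x hx => assign_map _ hx
    -- The fact used for `a` is the image of the covering atom `a₀` under `ν`.
    refine (hD _).2 ⟨a, ha, a₀, ha₀, _, hν a₀ ha₀, ⟨h, fun b hb hba => ?_⟩, ?_⟩
    · rw [List.map_congr_left fun x hx => hassign x (hba x hx)]
      exact hν b hb
    · rw [codedFact]
      congr 1
      refine List.map_congr_left fun v hv => ?_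
      have hv' : v ∈ p.vars := Query.mem_vars.2 ⟨a, ha, hv⟩
      rw [extend, dif_pos hv']
      exact congrArg code (List.map_congr_left fun x hx => (hassign x (h v hv x hx)).symm)
  · intro ν ν' _ _ h
    funext ⟨x, hx⟩
    obtain ⟨b, hb, hxb⟩ := Query.mem_vars.1 hx
    obtain ⟨a, ha, hab⟩ := hcover b hb
    obtain ⟨v, hv, hxv⟩ := (hab x).1 hxb
    have h1 := hcode (congrFun h ⟨v, Query.mem_vars.2 ⟨a, ha, hv⟩⟩)
    have h2 := List.map_inj_left.1 h1 x hxv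
    simpa only [extend, dif_pos hx] using h2
  · intro ν hν
    rw [mem_solutions_iff] at hν
    have hloc : ∀ a ∈ p, ∃ t : ℕ → ℕ, (∀ v ∈ a.args, extend ν v = code ((S v).map t)) ∧
        ∀ b ∈ q, (∀ x ∈ b.args, ∃ v ∈ a.args, x ∈ S v) →
          (⟨b.symbol, b.args.map t⟩ : Atom) ∈ D := by
      intro a ha
      obtain ⟨a', ha', a₀, ha₀, d, hd, ⟨h1, h2⟩, h3⟩ := (hD _).1 (hν a ha)
      rw [codedFact, Atom.mk.injEq] at h3
      -- The relation symbol of a fact identifies the atom for which it was made.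
      obtain rfl := hp a ha a' ha' h3.1
      refine ⟨assign a₀.args d.args, fun v hv => List.map_inj_left.1 h3.2 v hv,
        fun b hb h => h2 b hb fun x hx => ?_⟩
      obtain ⟨v, hv, hxv⟩ := h x hx
      exact h1 v hv x hxv
    choose! t ht htD using hloc
    have hconn : ∀ x, ∀ a ∈ p, ∀ v ∈ a.args, ∀ a' ∈ p, ∀ v' ∈ a'.args, x ∈ S v → x ∈ S v' →
        t a x = t a' x := by
      intro x a ha v hv a' ha' v' hv' hx hx'
      have hval : ∀ b ∈ p, ∀ b' ∈ p, ∀ w ∈ b.args, w ∈ b'.args → x ∈ S w → t b x = t b' x := by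
        intro b hb b' hb' w hw hw' hxw
        exact List.map_inj_left.1 (hcode ((ht b hb w hw).symm.trans (ht b' hb' w hw'))) x hxw
      -- The property carried along `p` is that all atoms containing `w` give `x` the same value as
      -- `a`. It passes between vertices of one edge, and between atoms that share `w` because the
      -- code of the tuple at `w` is injective.
      refine (hS.conn x (fun w => ∀ b ∈ p, w ∈ b.args → t a x = t b x) ?_ _
        (Query.mem_edges.2 ⟨a, ha, rfl⟩) v (by simpa using hv) _
        (Query.mem_edges.2 ⟨a', ha', rfl⟩) v' (by simpa using hv') (by simpa using hx)
        (by simpa using hx') fun b hb hvb => hval a ha b hb v hv hvb hx) a' ha' hv'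
      intro e he w hw w' hw' hxw hxw' hall b hb hwb
      obtain ⟨c, hc, rfl⟩ := Query.mem_edges.1 he
      rw [List.mem_toFinset] at hw hw' hxw hxw'
      exact (hall c hc hw).trans (hval c hc b hb w' hw' hwb hxw')
    -- A number outside all the lists `S v` is not a variable of `q`, so its value `0` is
    -- irrelevant.
    have hμ : ∀ x, ∃ y, ∀ a ∈ p, ∀ v ∈ a.args, x ∈ S v → t a x = y := by
      intro x
      by_cases h : ∃ a ∈ p, ∃ v ∈ a.args, x ∈ S v
      · obtain ⟨a, ha, v, hv, hx⟩ := h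
        exact ⟨t a x, fun a' ha' v' hv' hx' => (hconn x a ha v hv a' ha' v' hv' hx hx').symm⟩
      · exact ⟨0, fun a ha v hv hx => (h ⟨a, ha, v, hv, hx⟩).elim⟩
    choose μ hμ using hμ
    have hext : ∀ x ∈ q.vars, extend (fun x : Query.vars q => μ x) x = μ x := fun x hx => by
      simp [extend, hx]
    refine ⟨fun x => μ x, ?_, ?_⟩
    · rw [mem_solutions_iff]
      intro b hb
      obtain ⟨a, ha, hab⟩ := hcover b hb
      have := htD a ha b hb fun x hx => (hab x).1 hx
      rwa [List.map_congr_left (g := t a) fun x hx => ?_]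
      obtain ⟨v, hv, hxv⟩ := (hab x).1 hx
      rw [hext x (Query.mem_vars.2 ⟨b, hb, hx⟩), hμ x a ha v hv hxv]
    · funext ⟨v, hv⟩
      obtain ⟨a, ha, hva⟩ := Query.mem_vars.1 hv
      obtain ⟨a₀, ha₀, h⟩ := hsub a ha
      have h1 := ht a ha v hva
      rw [extend, dif_pos hv] at h1
      rw [h1]
      refine congrArg code (List.map_congr_left fun x hx => ?_)
      rw [hext x (Query.mem_vars.2 ⟨a₀, ha₀, h v hva x hx⟩), hμ x a ha v hva hx]

/-! ### Codes of lists of numbers -/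

/-- The number with the given binary digits. -/
def ofBits : List Bool → ℕ
  | [] => 0
  | b :: l => Nat.bit b (ofBits l)

theorem ofBits_pos (l : List Bool) : 0 < ofBits (l ++ [true]) := by
  induction l with
  | nil => simp [ofBits, Nat.bit]
  | cons b l ih =>
    rw [List.cons_append, ofBits, Nat.bit_val]
    omega

/-- The appended `true` becomes the most significant digit; without it, final `false` entries would
be lost. -/
theorem bits_ofBits (l : List Bool) : (ofBits (l ++ [true])).bits = l ++ [true] := by
  induction l with
  | nil => simp [ofBits, Nat.bit]
  | cons b l ih =>
    rw [List.cons_append, ofBits, Nat.bits_append_bit _ _ fun h => absurd h (ofBits_pos l).ne', ih]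

/-- The digits of a list of numbers, each marked with `true`, with `false` as a separator. -/
def listBits (l : List ℕ) : List Bool :=
  l.flatMap fun n => n.bits.flatMap (fun b => [true, b]) ++ [false]

/-- A number from which a list of numbers can be recovered. -/
def listCode (l : List ℕ) : ℕ := ofBits (listBits l ++ [true])

theorem bits_listCode (l : List ℕ) : (listCode l).bits = listBits l ++ [true] := bits_ofBits _

theorem bits_injective : Function.Injective Nat.bits := by
  intro m n h
  have : ∀ n : ℕ, ofBits n.bits = n := by
    intro n
    induction n using Nat.binaryRec' with
    | zero => rfl
    | bit b n h ih => rw [Nat.bits_append_bit _ _ h, ofBits, ih]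
  rw [← this m, h, this]

/-- The code is self-delimiting: in front of a digit stands `true`, and the first `false` in such a
position ends the number. -/
theorem listBits_injective : Function.Injective listBits := by
  have aux : ∀ (l m : List Bool) (u v : List Bool),
      l.flatMap (fun b => [true, b]) ++ false :: u = m.flatMap (fun b => [true, b]) ++ false :: v →
      l = m ∧ u = v := by
    intro l
    induction l with
    | nil => intro m u v h; cases m <;> simp_all
    | cons a l ih =>
      intro m u v h
      cases m with
      | nil => simp at h
      | cons b m =>
        simp only [List.flatMap_cons, List.cons_append, List.nil_append, List.cons.injEq,
          true_and] at h
        obtain ⟨h1, h2⟩ := ih _ _ _ h.2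
        exact ⟨by rw [h.1, h1], h2⟩
  intro l
  induction l with
  | nil =>
    intro m h
    cases m with
    | nil => rfl
    | cons b m =>
      have := congrArg List.length h
      simp [listBits] at this
  | cons a l ih =>
    intro m h
    cases m with
    | nil => simp [listBits] at h
    | cons b m =>
      simp only [listBits, List.flatMap_cons, List.append_assoc, List.singleton_append] at h
      obtain ⟨h1, h2⟩ := aux _ _ _ _ h
      rw [bits_injective h1, ih h2]

theorem listCode_injective : Function.Injective listCode := by
  intro l m h
  have := congrArg Nat.bits h
  rw [bits_listCode, bits_listCode] at this
  exact listBits_injective (List.append_cancel_right this)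

/-! ### The reduction on encoded instances -/

namespace Data

open Classical in
/-- The first value that a pair of atoms gives to an argument of the first atom. -/
noncomputable def lookup (a d x : Data) : Data :=
  (ofL ((zipPad a.snd.toL d.snd).filter fun z => z.fst = x)).fst.snd

/-- The counterpart of `listCode`. -/
def encodeList (l : Data) : Data :=
  ofL ((l.toL.flatMap fun n => (n.toL.flatMap fun b => [cons nil nil, b]) ++ [nil]) ++
    [cons nil nil])

/-- All entries of the lists in `s` are in `l`. -/
def Covers (s l : Data) : Prop := ∀ t ∈ s.toL, ∀ x ∈ t.toL, x ∈ l.toL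

/-- The counterpart of `Compatible`. -/
def CompatibleD (q D s a d : Data) : Prop :=
  Covers s a.snd ∧ ∀ b ∈ q.toL, (∀ x ∈ b.snd.toL, x ∈ a.snd.toL) →
    cons b.fst (ofL (b.snd.toL.map (lookup a d))) ∈ D.toL

open Classical in
/-- The database that belongs to an encoded model `y`. -/
noncomputable def codedDatabase (x y : Data) : Data :=
  ofL (y.toL.flatMap fun e => x.fst.toL.flatMap fun a => x.snd.toL.flatMap fun d =>
    if CompatibleD x.fst x.snd e.snd a d then
      [cons e.fst.fst (ofL (e.snd.toL.map fun s => encodeList (ofL (s.toL.map (lookup a d)))))]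
    else [])

/-- The instance that belongs to an encoded model `y`. -/
noncomputable def codedInstance (x y : Data) : Data :=
  cons (ofL (y.toL.map fst)) (codedDatabase x y)

/-- The edge set of the encoded query `q` is covered by the encoded candidate `y`. -/
def IsModelD (q y : Data) : Prop :=
  (∀ e ∈ y.toL, ∃ a ∈ q.toL, Covers e.snd a.snd) ∧
  ∀ a ∈ q.toL, ∃ e ∈ y.toL,
    (∀ x ∈ a.snd.toL, ∃ s ∈ e.snd.toL, x ∈ s.toL) ∧ Covers e.snd a.snd

open Classical in
/-- The variables of an encoded query, without repetitions. -/
noncomputable def queryVars (q : Data) : Data :=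
  ofL (q.toL.flatMap fun a => a.snd.toL).reverse.dedup

/-- The entries of `vs` at the positions in the list `l` of unary numbers. -/
def select (vs l : Data) : Data :=
  ofL (l.toL.flatMap fun i => (vs.toL.drop i.toL.length).take 1)

/-- The unary labels in a candidate are replaced by the entries of `vs`. -/
def resolve (vs y : Data) : Data :=
  ofL (y.toL.map fun e => cons e.fst (ofL (e.snd.toL.map (select vs))))

/-- The candidate `y` is a model of the query of `x`. -/
def Good (x y : Data) : Prop := IsModelD x.fst (resolve (queryVars x.fst) y)

/-- Some candidate in the list `z` is a model of the query of `x`. -/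
def Found (x z : Data) : Prop := ∃ y ∈ z.toL, Good x y

open Classical in
/-- The instance for the first candidate in the list `z` that is a model. -/
noncomputable def result (x z : Data) : Data :=
  codedInstance x (resolve (queryVars x.fst) (ofL (z.toL.filter fun y => Good x y)).fst)

end Data

/-! ### The reduction runs in polynomial time -/

namespace PolyTime

open Data

variable {A B C D E : Data → Data}

theorem lookup (hA : PolyTime A) (hB : PolyTime B) (hC : PolyTime C) :
    PolyTime fun x => lookup (A x) (B x) (C x) := by
  classical
  have := PolyTime.filter (R := fun x z => z.fst = C x) (hA.snd.zipPad hB.snd)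
    (.eq (.fst (.snd .id)) (hC.comp (.fst .id)))
  exact this.fst.snd.congr fun x => by rw [toL_ofL, Data.lookup]

theorem encodeList (hA : PolyTime A) : PolyTime fun x => encodeList (A x) := by
  have h1 : PolyTime fun z : Data => ofL (z.snd.toL.flatMap fun b => [Data.cons .nil .nil, b]) :=
    flatMap (F := fun _ b => .cons (.cons .nil .nil) (.cons b .nil)) (.snd .id)
      (.cons (.const _) (.cons (.snd .id) .nil))
  have h2 := flatMap (F := fun _ n => ofL ((n.toL.flatMap fun b => [Data.cons .nil .nil, b]) ++ [.nil]))
    hA ((h1.append (.const (.cons .nil .nil))).congr fun x => by simp)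
  refine (h2.append (.const (.cons (.cons .nil .nil) .nil))).congr fun x => ?_
  simp [Data.encodeList]

theorem _root_.CQDilution.PolyDec.covers (hA : PolyTime A) (hB : PolyTime B) :
    PolyDec fun x => Covers (A x) (B x) :=
  .forall_mem hA (.forall_mem (.snd .id) (.mem (.snd .id) (hB.comp (.fst (.fst .id)))))

theorem _root_.CQDilution.PolyDec.imp {P Q : Data → Prop} (hP : PolyDec P) (hQ : PolyDec Q) :
    PolyDec fun x => P x → Q x :=
  (hP.not.or hQ).congr fun x => by tauto

theorem _root_.CQDilution.PolyDec.compatibleD (hA : PolyTime A) (hB : PolyTime B)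
    (hC : PolyTime C) (hD : PolyTime D) (hE : PolyTime E) :
    PolyDec fun x => CompatibleD (A x) (B x) (C x) (D x) (E x) := by
  refine (PolyDec.covers hC hD.snd).and (.forall_mem hA (.imp ?_ ?_))
  · exact .subset (.snd (.snd .id)) (hD.snd.comp (.fst .id))
  · exact .mem (.cons (.fst (.snd .id)) (.map (F := fun z => Data.lookup (D z.fst) (E z.fst))
      (.snd (.snd .id)) (.lookup (hD.comp (.fst (.fst .id))) (hE.comp (.fst (.fst .id)))
        (.snd .id)))) (hB.comp (.fst .id))

/-- Each of the nested loops pairs its environment with the current entry: in the innermost one,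
`z.fst.fst` is the input, `z.fst.snd` the atom of the candidate and `z.snd` the atom of the query.
-/
theorem codedDatabase (hA : PolyTime A) (hB : PolyTime B) :
    PolyTime fun x => codedDatabase (A x) (B x) := by
  classical
  refine (flatMap (F := fun x e => ofL ((A x).fst.toL.flatMap fun a => (A x).snd.toL.flatMap fun d =>
    if CompatibleD (A x).fst (A x).snd e.snd a d then
      [Data.cons e.fst.fst (ofL (e.snd.toL.map fun s =>
        Data.encodeList (ofL (s.toL.map (Data.lookup a d)))))]
    else [])) hB ?_).congr fun x => by simp [Data.codedDatabase]
  refine (flatMap (F := fun z a => ofL ((A z.fst).snd.toL.flatMap fun d =>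
    if CompatibleD (A z.fst).fst (A z.fst).snd z.snd.snd a d then
      [Data.cons z.snd.fst.fst (ofL (z.snd.snd.toL.map fun s =>
        Data.encodeList (ofL (s.toL.map (Data.lookup a d)))))]
    else [])) (hA.fst.comp (.fst .id)) ?_).congr fun x => by simp
  refine (flatMap (F := fun z d =>
    if CompatibleD (A z.fst.fst).fst (A z.fst.fst).snd z.fst.snd.snd z.snd d then
      .cons (Data.cons z.fst.snd.fst.fst (ofL (z.fst.snd.snd.toL.map fun s =>
        Data.encodeList (ofL (s.toL.map (Data.lookup z.snd d)))))) .nil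
    else .nil) (hA.snd.comp (.fst (.fst .id))) ?_).congr fun x => ?_
  · have h : PolyTime fun z : Data => A z.fst.fst.fst := hA.comp (.fst (.fst (.fst .id)))
    have h1 : PolyTime fun z : Data => z.fst.fst.snd := .snd (.fst (.fst .id))
    refine .ite (.compatibleD h.fst h.snd h1.snd (.snd (.fst .id)) (.snd .id)) (.cons
      (.cons h1.fst.fst (.map h1.snd (.encodeList (.map (F := fun z =>
        Data.lookup z.fst.fst.snd z.fst.snd) (.snd .id) (.lookup ?_ ?_ (.snd .id)))))) .nil) .nil
    · exact .snd (.fst (.fst (.fst .id)))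
    · exact .snd (.fst (.fst .id))
  · congr 1
    refine List.flatMap_congr fun d _ => ?_
    split_ifs <;> simp

theorem codedInstance (hA : PolyTime A) (hB : PolyTime B) :
    PolyTime fun x => codedInstance (A x) (B x) :=
  .cons (.map (F := fun _ => Data.fst) hB (.fst (.snd .id))) (.codedDatabase hA hB)

theorem _root_.CQDilution.PolyDec.isModelD (hA : PolyTime A) (hB : PolyTime B) :
    PolyDec fun x => IsModelD (A x) (B x) := by
  refine (PolyDec.forall_mem hB (.exists_mem (hA.comp (.fst .id))
    (.covers (A := fun z => z.fst.snd.snd) (B := fun z => z.snd.snd) ?_ ?_))).and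
    (.forall_mem hA (.exists_mem (hB.comp (.fst .id)) (.and (.forall_mem ?_ (.exists_mem ?_
      (.mem ?_ ?_))) (.covers (A := fun z => z.snd.snd) (B := fun z => z.fst.snd.snd) ?_ ?_))))
  · exact .snd (.snd (.fst .id))
  · exact .snd (.snd .id)
  · exact .snd (.snd (.fst .id))
  · exact .snd (.snd (.fst .id))
  · exact .snd (.fst .id)
  · exact .snd .id
  · exact .snd (.snd .id)
  · exact .snd (.snd (.fst .id))

theorem queryVars (hA : PolyTime A) : PolyTime fun x => queryVars (A x) := by
  classical
  -- `List.dedup` keeps last occurrences, whereas the fold keeps first ones and conses them in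
  -- front; hence the reversed list.
  have hfold : ∀ l d : List Data, l.foldl (fun acc a => if a ∈ acc.toL then acc else .cons a acc)
      (ofL d.dedup) = ofL (l.reverse ++ d).dedup := by
    intro l
    induction l with
    | nil => simp
    | cons a l ih =>
      intro d
      rw [List.foldl_cons, List.reverse_cons, List.append_assoc, List.singleton_append, ← ih]
      congr 1
      by_cases h : a ∈ d <;> simp [h, ofL]
  have hocc := flatMap (F := fun _ a => a.snd) hA (.snd (.snd .id))
  obtain ⟨P, hP⟩ := hocc.size_le
  have := foldl (F := fun _ acc a => if a ∈ acc.toL then acc else .cons a acc) hocc nil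
    (.ite (.mem (.snd (.snd .id)) (.fst (.snd .id))) (.fst (.snd .id))
      (.cons (.snd (.snd .id)) (.fst (.snd .id)))) P ?_
  · refine this.congr fun x => ?_
    simpa [ofL, Data.queryVars] using hfold (ofL ((A x).toL.flatMap fun a => a.snd.toL)).toL []
  · intro x l₁ l₂ h
    refine le_trans ?_ (hP x)
    have h1 := hfold l₁ []
    rw [List.dedup_nil, ofL, List.append_nil] at h1
    rw [h1, size_ofL, size_eq_toL (ofL _), h, add_le_add_iff_right, List.map_append,
      List.sum_append]
    refine le_trans ?_ (Nat.le_add_right _ _)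
    refine (((List.dedup_sublist _).map _).sum_le_sum fun _ _ => Nat.zero_le _).trans ?_
    rw [List.map_reverse, List.sum_reverse]

theorem select (hA : PolyTime A) (hB : PolyTime B) : PolyTime fun x => select (A x) (B x) := by
  classical
  have h := (hA.comp (.fst .id)).drop (.snd .id)
  have h1 := h.ite_eq_nil (.cons h.fst .nil) .nil
  refine (flatMap (F := fun x i => ofL (((A x).toL.drop i.toL.length).take 1)) hB
    (h1.congr fun z => ?_)).congr fun x => by simp [Data.select]
  cases (A z.fst).toL.drop z.snd.toL.length <;> simp [ofL]

theorem resolve (hA : PolyTime A) (hB : PolyTime B) : PolyTime fun x => resolve (A x) (B x) :=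
  .map hB (.cons (.fst (.snd .id)) (.map (F := fun z => Data.select (A z.fst)) (.snd (.snd .id))
    (.select (A := fun z => A z.fst.fst) (hA.comp (.fst (.fst .id))) (.snd .id))))

theorem _root_.CQDilution.PolyDec.good (hA : PolyTime A) (hB : PolyTime B) :
    PolyDec fun x => Good (A x) (B x) :=
  .isModelD hA.fst (.resolve hA.fst.queryVars hB)

theorem _root_.CQDilution.PolyDec.found (hA : PolyTime A) (hB : PolyTime B) :
    PolyDec fun x => Found (A x) (B x) :=
  .exists_mem hB (.good (A := fun z => A z.fst) (hA.comp (.fst .id)) (.snd .id))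

theorem result (hA : PolyTime A) (hB : PolyTime B) : PolyTime fun x => result (A x) (B x) := by
  classical
  exact .codedInstance hA (.resolve hA.fst.queryVars (.fst (.filter (R := fun x y => Good (A x) y)
    hB (.good (A := fun z => A z.fst) (hA.comp (.fst .id)) (.snd .id)))))

end PolyTime

/-! ### Correctness on encodings of queries and databases -/

namespace Data

theorem ofBool_injective : Function.Injective ofBool := by
  intro a b
  cases a <;> cases b <;> simp [ofBool]

theorem ofL_injective : Function.Injective ofL := fun a b h => by
  rw [← toL_ofL a, h, toL_ofL]

theorem eq_of_toL_eq {a b : Data} (h : a.toL = b.toL) : a = b := by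
  rw [← ofL_toL a, h, ofL_toL]

theorem ofList_injective {α : Type} {enc : α → Data} (h : Function.Injective enc) :
    Function.Injective (ofList enc) := by
  intro l m hlm
  rw [ofList_eq, ofList_eq] at hlm
  exact h.list_map (ofL_injective hlm)

theorem ofNat_injective : Function.Injective ofNat := fun _ _ h =>
  bits_injective (ofList_injective ofBool_injective h)

@[simp] theorem ofNat_inj {m n : ℕ} : ofNat m = ofNat n ↔ m = n := ofNat_injective.eq_iff

theorem ofAtom_injective : Function.Injective ofAtom := by
  rintro ⟨s, a⟩ ⟨s', a'⟩ h
  simp only [ofAtom, cons.injEq] at h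
  rw [ofNat_injective h.1, ofList_injective ofNat_injective h.2]

@[simp] theorem fst_ofAtom (a : Atom) : (ofAtom a).fst = ofNat a.symbol := rfl

@[simp] theorem snd_ofAtom (a : Atom) : (ofAtom a).snd = ofList ofNat a.args := rfl

/-- The defaults agree: `nil` is the encoding of `0`, both for a variable that is not found and for
a fact with too few arguments. -/
theorem lookup_ofAtom (a d : Atom) (x : ℕ) :
    lookup (ofAtom a) (ofAtom d) (ofNat x) = ofNat (assign a.args d.args x) := by
  classical
  obtain ⟨s, l⟩ := a
  obtain ⟨s', ds⟩ := d
  simp only [lookup, snd_ofAtom, toL_ofList]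
  induction l generalizing ds with
  | nil => rfl
  | cons a l ih =>
    have h1 : (ofList ofNat ds).fst = ofNat ds.headI := by cases ds <;> rfl
    have h2 : (ofList ofNat ds).snd = ofList ofNat ds.tail := by cases ds <;> rfl
    by_cases h : a = x
    · simp [zipPad, assign, h, h1, ofL]
    · simp only [zipPad, List.map_cons, assign, h, if_false, h2, ← ih]
      rw [List.filter_cons_of_neg (by simpa using h)]

theorem map_lookup_ofAtom (a d : Atom) (l : List ℕ) :
    (l.map ofNat).map (lookup (ofAtom a) (ofAtom d)) = (l.map (assign a.args d.args)).map ofNat := by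
  rw [List.map_map, List.map_map]
  exact List.map_congr_left fun x _ => lookup_ofAtom a d x

theorem encodeList_ofList (l : List ℕ) : encodeList (ofList ofNat l) = ofNat (listCode l) := by
  rw [ofNat, bits_listCode, encodeList, listBits]
  refine eq_of_toL_eq ?_
  simp only [toL_ofL, toL_ofList, List.map_append, List.map_flatMap, List.flatMap_map, List.map_cons,
    List.map_nil, ofNat, ofBool]

/-- The encoding of a query together with lists of labels for its variables. -/
def ofModel (enc : ℕ → Data) (p : Query) (S : ℕ → List ℕ) : Data :=
  ofList (fun a => cons (ofAtom a) (ofList (fun v => ofList enc (S v)) a.args)) p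

variable {p q : Query} {D : Database} {S : ℕ → List ℕ} {a : Atom}

theorem covers_iff {l : List ℕ} : Covers (ofList (fun v => ofList ofNat (S v)) a.args)
    (ofList ofNat l) ↔ ∀ v ∈ a.args, ∀ x ∈ S v, x ∈ l := by
  simp [Covers]

theorem compatibleD_iff {a₀ d : Atom} : CompatibleD (ofList ofAtom q) (ofList ofAtom D)
    (ofList (fun v => ofList ofNat (S v)) a.args) (ofAtom a₀) (ofAtom d) ↔
    Compatible q D S a a₀ d := by
  have h : ∀ b : Atom, cons (ofAtom b).fst (ofL (((ofAtom b).snd.toL).map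
      (lookup (ofAtom a₀) (ofAtom d)))) ∈ (ofList ofAtom D).toL ↔
      (⟨b.symbol, b.args.map (assign a₀.args d.args)⟩ : Atom) ∈ D := by
    intro b
    rw [snd_ofAtom, toL_ofList, toL_ofList, map_lookup_ofAtom, ← ofList_eq,
      ← List.mem_map_of_injective ofAtom_injective]
    rfl
  rw [CompatibleD, Compatible, snd_ofAtom, covers_iff]
  simp only [toL_ofList, List.forall_mem_map] at h ⊢
  refine and_congr_right fun _ => forall₂_congr fun b _ => ?_
  rw [h b]
  simp [toL_ofList]

open Classical in
/-- The database of coded facts. -/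
noncomputable def _root_.CQDilution.codedFacts (p q : Query) (D : Database) (S : ℕ → List ℕ) :
    Database :=
  p.flatMap fun a => q.flatMap fun a₀ => D.flatMap fun d =>
    if Compatible q D S a a₀ d then [codedFact listCode S a a₀ d] else []

theorem ofAtom_codedFact {a₀ d : Atom} : ofAtom (codedFact listCode S a a₀ d) =
    cons (ofAtom a).fst (ofL ((a.args.map fun v => ofList ofNat (S v)).map fun s =>
      encodeList (ofL (s.toL.map (lookup (ofAtom a₀) (ofAtom d)))))) := by
  rw [codedFact, ofAtom, fst_ofAtom]
  congr 1
  refine eq_of_toL_eq ?_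
  simp only [toL_ofL, toL_ofList, List.map_map]
  refine List.map_congr_left fun v _ => ?_
  simp only [Function.comp, toL_ofList]
  rw [map_lookup_ofAtom, ← ofList_eq, encodeList_ofList]

theorem codedInstance_ofModel :
    codedInstance (cons (ofList ofAtom q) (ofList ofAtom D)) (ofModel ofNat p S) =
      cons (ofList ofAtom p) (ofList ofAtom (codedFacts p q D S)) := by
  classical
  rw [codedInstance, codedDatabase, ofModel]
  simp only [toL_ofList, List.map_map, fst_cons, snd_cons, List.flatMap_map, compatibleD_iff]
  congr 1
  · exact (ofList_eq _ _).symm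
  · rw [ofList_eq, codedFacts]
    simp only [List.map_flatMap]
    congr 1
    refine List.flatMap_congr fun a _ => List.flatMap_congr fun a₀ _ =>
      List.flatMap_congr fun d _ => ?_
    split_ifs
    · rw [List.map_singleton, ofAtom_codedFact, List.map_map]
    · rfl

theorem isModelD_iff : IsModelD (ofList ofAtom q) (ofModel ofNat p S) ↔
    (∀ e ∈ p.hypergraph.edges, ∃ f ∈ q.hypergraph.edges, ∀ v ∈ e, (S v).toFinset ⊆ f) ∧
    ∀ f ∈ q.hypergraph.edges, ∃ e ∈ p.hypergraph.edges, e.biUnion (fun v => (S v).toFinset) = f := by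
  have h1 : ∀ a : Atom, ∀ b : Atom, Covers (ofList (fun v => ofList ofNat (S v)) a.args)
    (ofAtom b).snd ↔ ∀ v ∈ a.args.toFinset, (S v).toFinset ⊆ b.args.toFinset := by
    intro a b
    rw [snd_ofAtom, covers_iff]
    simp [Finset.subset_iff]
  rw [IsModelD]
  simp only [ofModel, toL_ofList, List.forall_mem_map]
  simp only [List.mem_map, exists_exists_and_eq_and, snd_cons, h1]
  refine and_congr ?_ ?_
  · simp [Query.mem_edges]
  · simp only [Query.mem_edges, forall_exists_index, and_imp, forall_apply_eq_imp_iff₂]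
    refine forall₂_congr fun b hb => ?_
    constructor
    · rintro ⟨a, ha, h2, h3⟩
      refine ⟨_, ⟨a, ha, rfl⟩, subset_antisymm (Finset.biUnion_subset.2 h3) fun x hx => ?_⟩
      obtain ⟨s, hs, hx⟩ := h2 (ofNat x) (by simpa using hx)
      obtain ⟨v, hv, rfl⟩ := List.mem_map.1 (by simpa using hs)
      simp only [Finset.mem_biUnion, List.mem_toFinset]
      exact ⟨v, hv, by simpa using hx⟩
    · rintro ⟨_, ⟨a, ha, rfl⟩, h⟩
      refine ⟨a, ha, fun x hx => ?_, Finset.biUnion_subset.1 h.le⟩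
      rw [snd_ofAtom, toL_ofList, List.mem_map] at hx
      obtain ⟨x, hx, rfl⟩ := hx
      have := h.ge (by simpa using hx : x ∈ b.args.toFinset)
      simpa using this

/-- The variables of a query, without repetitions. -/
def _root_.CQDilution.Query.varList (q : Query) : List ℕ :=
  (q.flatMap Atom.args).reverse.dedup

theorem queryVars_ofList : queryVars (ofList ofAtom q) = ofList ofNat q.varList := by
  classical
  have h : ((ofList ofAtom q).toL.flatMap fun a => a.snd.toL) =
      (q.flatMap Atom.args).map ofNat := by
    simp only [toL_ofList, List.flatMap_map, List.map_flatMap, snd_ofAtom]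
  rw [queryVars, h, ← List.map_reverse, List.dedup_map_of_injective ofNat_injective, ← ofList_eq,
    Query.varList]

/-- The variables at the given positions. -/
def _root_.CQDilution.selectVars (vs : List ℕ) (l : List ℕ) : List ℕ :=
  l.flatMap fun i => (vs.drop i).take 1

theorem select_ofList (vs l : List ℕ) :
    select (ofList ofNat vs) (ofList unary l) = ofList ofNat (selectVars vs l) := by
  rw [select, ofList_eq ofNat (selectVars vs l), selectVars]
  simp only [toL_ofList, List.flatMap_map, length_toL_unary, List.map_flatMap, List.map_take,
    List.map_drop]

theorem resolve_ofModel (vs : List ℕ) : resolve (ofList ofNat vs) (ofModel unary p S) =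
    ofModel ofNat p fun v => selectVars vs (S v) := by
  rw [resolve, ofModel, ofModel]
  refine eq_of_toL_eq ?_
  simp only [toL_ofL, toL_ofList, List.map_map]
  refine List.map_congr_left fun a _ => ?_
  simp only [Function.comp, fst_cons, snd_cons, toL_ofList, List.map_map]
  congr 1
  refine eq_of_toL_eq ?_
  simp only [toL_ofL, toL_ofList]
  exact List.map_congr_left fun v _ => select_ofList vs (S v)

end Data

/-! ### Enumeration of candidates -/

theorem primrecPred_forall_mem {α β : Type} [Primcodable α] [Primcodable β] {f : α → List β}
    {p : α → β → Prop} (hf : Primrec f) (hp : PrimrecPred fun z : α × β => p z.1 z.2) :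
    PrimrecPred fun a => ∀ b ∈ f a, p a b := by
  have h : PrimrecRel fun (b : β) (a : α) => p a b := hp.comp (Primrec.snd.pair Primrec.fst)
  exact h.forall_mem_list.comp hf Primrec.id

theorem primrecPred_exists_mem {α β : Type} [Primcodable α] [Primcodable β] {f : α → List β}
    {p : α → β → Prop} (hf : Primrec f) (hp : PrimrecPred fun z : α × β => p z.1 z.2) :
    PrimrecPred fun a => ∃ b ∈ f a, p a b := by
  have h : PrimrecRel fun (b : β) (a : α) => p a b := hp.comp (Primrec.snd.pair Primrec.fst)
  exact h.exists_mem_list.comp hf Primrec.id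

theorem primrecPred_mem {α β : Type} [Primcodable α] [Primcodable β] {f : α → β} {l : α → List β}
    (hf : Primrec f) (hl : Primrec l) : PrimrecPred fun a => f a ∈ l a :=
  (primrecPred_exists_mem (p := fun a b => b = f a) hl
    (Primrec.eq.comp Primrec.snd (hf.comp Primrec.fst))).of_eq fun a => by simp

theorem primrec_sublists' {α : Type} [Primcodable α] : Primrec (@List.sublists' α) := by
  have h : Primrec fun z : List α × α × List (List α) => z.2.2 ++ z.2.2.map (List.cons z.2.1) := by
    refine Primrec.list_append.comp (Primrec.snd.comp Primrec.snd)
      (Primrec.list_map (Primrec.snd.comp Primrec.snd) ?_)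
    exact Primrec.list_cons.comp (Primrec.fst.comp (Primrec.snd.comp Primrec.fst)) Primrec.snd
  refine (Primrec.list_foldr (f := fun l : List α => l) (g := fun _ => [[]])
    (h := fun _ z => z.2 ++ z.2.map (List.cons z.1)) .id (.const _) h.to₂).of_eq fun l => ?_
  induction l with
  | nil => rfl
  | cons a l ih => rw [List.foldr_cons, ih, List.sublists'_cons]

theorem Data.primrec_ofList₂ {α β : Type} [Primcodable α] [Primcodable β] {f : α → List β}
    {enc : α → β → Data} (hf : Primrec f) (h : Primrec₂ enc) :
    Primrec fun a => Data.ofList (enc a) (f a) :=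
  ((Data.primrec_ofList Primrec.id).comp (Primrec.list_map hf h)).of_eq fun a => by
    rw [Data.ofList_eq, Data.ofList_eq (enc a), List.map_id]

/-- The query with one atom for every set in the list `c`. -/
def queryOf (c : List (List ℕ)) : Query :=
  (List.range c.length).map fun i => ⟨i, c.getD i []⟩

theorem edges_queryOf (c : List (List ℕ)) :
    (queryOf c).hypergraph.edges = (c.map List.toFinset).toFinset := by
  ext e
  simp only [Query.mem_edges, queryOf, List.mem_map, List.mem_range, List.mem_toFinset]
  constructor
  · rintro ⟨_, ⟨i, hi, rfl⟩, rfl⟩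
    exact ⟨_, List.getD_eq_getElem c [] hi ▸ List.getElem_mem hi, rfl⟩
  · rintro ⟨l, hl, rfl⟩
    obtain ⟨i, hi, rfl⟩ := List.mem_iff_getElem.1 hl
    exact ⟨_, ⟨i, hi, rfl⟩, by rw [List.getD_eq_getElem c [] hi]⟩

/-- The numbers related to `v`. -/
def labels (R : List (ℕ × ℕ)) (v : ℕ) : List ℕ := (R.filter fun z => z.1 = v).map Prod.snd

theorem mem_labels {R : List (ℕ × ℕ)} {v i : ℕ} : i ∈ labels R v ↔ (v, i) ∈ R := by
  simp [labels]

/-- For all `i < k`, the entries of the lists in `c` that are related to `i` are connected. -/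
def Connected (c : List (List ℕ)) (k : ℕ) (R : List (ℕ × ℕ)) : Prop :=
  ∀ A ∈ c.flatten.sublists', ∀ i ∈ List.range k, (∃ v ∈ A, (v, i) ∈ R) →
    (∃ v ∈ c.flatten, v ∉ A ∧ (v, i) ∈ R) →
    ∃ e ∈ c, (∃ v ∈ e, v ∈ A ∧ (v, i) ∈ R) ∧ ∃ v ∈ e, v ∉ A ∧ (v, i) ∈ R

open Classical in
/-- The connected relations between the entries of the lists in `c` and the numbers below `k`. -/
noncomputable def relations (c : List (List ℕ)) (k : ℕ) : List (List (ℕ × ℕ)) :=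
  (c.flatten.flatMap fun v => (List.range k).map fun i => (v, i)).sublists'.filter
    fun R => Connected c k R

/-- Expressing connectivity by cuts leaves only quantifiers over finite lists. The exponential
number of cuts is harmless, since the candidates depend on `c` and `k` alone. -/
theorem primrecPred_connected :
    PrimrecPred fun x : List (ℕ × ℕ) × List (List ℕ) × ℕ => Connected x.2.1 x.2.2 x.1 := by
  have imp : ∀ {α : Type} [Primcodable α] {p q : α → Prop}, PrimrecPred p → PrimrecPred q →
      PrimrecPred fun a => p a → q a := fun hp hq =>
    (hp.not.or hq).of_eq fun a => by tauto
  have hc : Primrec fun x : List (ℕ × ℕ) × List (List ℕ) × ℕ => x.2.1 :=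
    Primrec.fst.comp Primrec.snd
  have hk : Primrec fun x : List (ℕ × ℕ) × List (List ℕ) × ℕ => x.2.2 :=
    Primrec.snd.comp Primrec.snd
  refine primrecPred_forall_mem (primrec_sublists'.comp (Primrec.list_flatten.comp hc))
    (primrecPred_forall_mem (Primrec.list_range.comp (hk.comp Primrec.fst)) ?_)
  have hR : Primrec fun z : ((List (ℕ × ℕ) × List (List ℕ) × ℕ) × List ℕ) × ℕ => z.1.1.1 :=
    Primrec.fst.comp (Primrec.fst.comp Primrec.fst)
  have hc' : Primrec fun z : ((List (ℕ × ℕ) × List (List ℕ) × ℕ) × List ℕ) × ℕ => z.1.1.2.1 :=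
    hc.comp (Primrec.fst.comp Primrec.fst)
  have hA : Primrec fun z : ((List (ℕ × ℕ) × List (List ℕ) × ℕ) × List ℕ) × ℕ => z.1.2 :=
    Primrec.snd.comp Primrec.fst
  have hi : Primrec fun z : ((List (ℕ × ℕ) × List (List ℕ) × ℕ) × List ℕ) × ℕ => z.2 :=
    Primrec.snd
  have hrel : ∀ {γ : Type} [Primcodable γ]
      {g : γ → ((List (ℕ × ℕ) × List (List ℕ) × ℕ) × List ℕ) × ℕ} {v : γ → ℕ}, Primrec g →
      Primrec v → PrimrecPred fun y : γ => (v y, (g y).2) ∈ (g y).1.1.1 := fun hg hv =>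
    primrecPred_mem (hv.pair (hi.comp hg)) (hR.comp hg)
  have hin : ∀ {γ : Type} [Primcodable γ]
      {g : γ → ((List (ℕ × ℕ) × List (List ℕ) × ℕ) × List ℕ) × ℕ} {v : γ → ℕ}, Primrec g →
      Primrec v → PrimrecPred fun y : γ => v y ∈ (g y).1.2 := fun hg hv =>
    primrecPred_mem hv (hA.comp hg)
  refine imp (primrecPred_exists_mem hA (hrel Primrec.fst Primrec.snd))
    (imp (primrecPred_exists_mem (Primrec.list_flatten.comp hc')
      ((hin Primrec.fst Primrec.snd).not.and (hrel Primrec.fst Primrec.snd))) ?_)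
  refine primrecPred_exists_mem hc' (PrimrecPred.and ?_ ?_)
  · exact primrecPred_exists_mem Primrec.snd ((hin (Primrec.fst.comp Primrec.fst) Primrec.snd).and
      (hrel (Primrec.fst.comp Primrec.fst) Primrec.snd))
  · exact primrecPred_exists_mem Primrec.snd
      ((hin (Primrec.fst.comp Primrec.fst) Primrec.snd).not.and
        (hrel (Primrec.fst.comp Primrec.fst) Primrec.snd))

theorem primrec_relations : Primrec₂ relations := by
  classical
  have h : PrimrecRel fun (R : List (ℕ × ℕ)) (y : List (List ℕ) × ℕ) => Connected y.1 y.2 R :=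
    primrecPred_connected
  refine h.listFilter.comp (primrec_sublists'.comp (Primrec.list_flatMap
    (Primrec.list_flatten.comp Primrec.fst) ?_)) Primrec.id
  have h1 : Primrec₂ fun (z : (List (List ℕ) × ℕ) × ℕ) (i : ℕ) => (z.2, i) :=
    (Primrec.snd.comp Primrec.fst).pair Primrec.snd
  exact Primrec.list_map (Primrec.list_range.comp (Primrec.snd.comp Primrec.fst)) h1

theorem primrec_labels : Primrec₂ labels := by
  have h : PrimrecRel fun (z : ℕ × ℕ) (v : ℕ) => z.1 = v :=
    Primrec.eq.comp (Primrec.fst.comp Primrec.fst) Primrec.snd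
  exact Primrec.list_map (h.listFilter.comp Primrec.fst Primrec.snd)
    (Primrec.snd.comp Primrec.snd).to₂

/-- The encoded candidates in the hypergraph with the edges in the list `c`, for queries with at
most `k` variables. -/
noncomputable def candidates (c : List (List ℕ)) (k : ℕ) : Data :=
  Data.ofList (fun R => Data.ofModel Data.unary (queryOf c) (labels R)) (relations c k)

open Data in
theorem primrec_candidates : Primrec₂ candidates := by
  refine Data.primrec_ofList₂ primrec_relations ?_
  have h : Primrec fun z : (List (List ℕ) × ℕ) × List (ℕ × ℕ) =>
      ofList (fun i => cons (ofAtom ⟨i, z.1.1.getD i []⟩)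
        (ofList (fun v => ofList unary (labels z.2 v)) (z.1.1.getD i [])))
        (List.range z.1.1.length) := by
    have hc : Primrec fun z : (List (List ℕ) × ℕ) × List (ℕ × ℕ) => z.1.1 :=
      Primrec.fst.comp Primrec.fst
    have he : Primrec fun y : ((List (List ℕ) × ℕ) × List (ℕ × ℕ)) × ℕ => y.1.1.1.getD y.2 [] :=
      (Primrec.list_getD []).comp (hc.comp Primrec.fst) Primrec.snd
    refine primrec_ofList₂ (Primrec.list_range.comp (Primrec.list_length.comp hc))
      (primrec_cons.comp (primrec_ofAtom Primrec.snd he) (primrec_ofList₂ he ?_))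
    exact (primrec_ofList primrec_unary).comp (primrec_labels.comp
      (Primrec.snd.comp (Primrec.fst.comp Primrec.fst)) Primrec.snd)
  refine h.of_eq fun z => ?_
  refine eq_of_toL_eq ?_
  simp only [ofModel, queryOf, toL_ofList, List.map_map]
  rfl

/-- The number `k` codes an element and is itself the step bound for the semi-decision. Every
element recurs arbitrarily late, so that a hypergraph reappears at a stage exceeding the number of
variables. -/
theorem exists_enumeration {α : Type} [Primcodable α] {P : α → Prop} (hP : REPred P) :
    ∃ g : ℕ → Option α, Computable g ∧ (∀ k a, g k = some a → P a) ∧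
      ∀ a, P a → ∀ n, ∃ k ≥ n, g k = some a := by
  obtain ⟨cf, hcf⟩ := Nat.Partrec.Code.exists_code.1 hP
  have heval : ∀ n (a : α), Encodable.decode n = some a → ((cf.eval n).Dom ↔ P a) := by
    intro n a h
    rw [hcf]
    simp [Part.assert, h]
  refine ⟨fun k => if (cf.evaln k k.unpair.1).isSome then Encodable.decode k.unpair.1 else none,
    ?_, ?_, ?_⟩
  · have h1 : Primrec fun k : ℕ => (cf.evaln k k.unpair.1).isSome :=
      Primrec.option_isSome.comp (Nat.Partrec.Code.primrec_evaln.comp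
        ((Primrec.id.pair (.const cf)).pair (Primrec.fst.comp Primrec.unpair)))
    exact (Primrec.ite (Primrec.eq.comp h1 (.const true)) (Primrec.decode.comp
      (Primrec.fst.comp Primrec.unpair)) (.const none)).to_comp
  · intro k a h
    dsimp only at h
    split_ifs at h with h1
    obtain ⟨y, hy⟩ := Option.isSome_iff_exists.1 h1
    exact (heval _ _ h).1 (Part.dom_iff_mem.2 ⟨y, Nat.Partrec.Code.evaln_sound hy⟩)
  · intro a ha n
    obtain ⟨y, hy⟩ := Part.dom_iff_mem.1 ((heval _ a (Encodable.encodek a)).2 ha)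
    obtain ⟨k, hk⟩ := Nat.Partrec.Code.evaln_complete.1 hy
    -- The second component serves only to make the pair at least as large as the required step
    -- bound and as `n`.
    refine ⟨Nat.pair (Encodable.encode a) (max k n),
      (le_max_right _ _).trans (Nat.right_le_pair _ _), ?_⟩
    have := Nat.Partrec.Code.evaln_mono ((le_max_left k n).trans (Nat.right_le_pair
      (Encodable.encode a) _)) hk
    rw [Option.mem_def] at this
    simp [this]

/-! ### Candidates and models -/

theorem IsModel.congr {E F : Finset (Finset ℕ)} {S T : ℕ → Finset ℕ} (h : IsModel E F S)
    (hST : ∀ e ∈ E, ∀ v ∈ e, S v = T v) : IsModel E F T where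
  sub e he := by
    obtain ⟨f, hf, h'⟩ := h.sub e he
    exact ⟨f, hf, fun v hv => hST e he v hv ▸ h' v hv⟩
  cover f hf := by
    obtain ⟨e, he, rfl⟩ := h.cover f hf
    exact ⟨e, he, (Finset.biUnion_congr rfl (hST e he)).symm⟩
  conn u A hA e he v hv e' he' v' hv' hu hu' :=
    h.conn u A (fun e he v hv v' hv' hu hu' =>
      hA e he v hv v' hv' (hST e he v hv ▸ hu) (hST e he v' hv' ▸ hu'))
      e he v hv e' he' v' hv' (hST e he v hv ▸ hu) (hST e' he' v' hv' ▸ hu')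

theorem mem_selectVars {vs l : List ℕ} {u : ℕ} :
    u ∈ selectVars vs l ↔ ∃ i ∈ l, vs[i]? = some u := by
  rw [selectVars, List.mem_flatMap]
  refine exists_congr fun i => and_congr_right fun _ => ?_
  rw [← List.head?_drop]
  cases vs.drop i <;> simp [eq_comm]

theorem nodup_varList (q : Query) : q.varList.Nodup := List.nodup_dedup _

theorem mem_varList {q : Query} {x : ℕ} : x ∈ q.varList ↔ x ∈ q.vars := by
  simp [Query.varList, Query.vars]

theorem length_varList (q : Query) : q.varList.length = q.hypergraph.verts.card := by
  have : q.varList.toFinset = q.vars := by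
    ext x
    simp [mem_varList]
  rw [← List.toFinset_card_of_nodup (nodup_varList q), this]
  rfl

variable {c : List (List ℕ)} {k : ℕ} {R : List (ℕ × ℕ)} {vs : List ℕ}

theorem lt_of_mem_relations (hR : R ∈ relations c k) {v i : ℕ} (h : (v, i) ∈ R) : i < k := by
  classical
  rw [relations, List.mem_filter, List.mem_sublists'] at hR
  have := hR.1.subset h
  simp only [List.mem_flatMap, List.mem_map, List.mem_range, Prod.mk.injEq] at this
  obtain ⟨_, _, j, hj, _, rfl⟩ := this
  exact hj

theorem mem_flatten_of_mem_edges {e : Finset ℕ} (he : e ∈ (queryOf c).hypergraph.edges) {v : ℕ}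
    (hv : v ∈ e) : v ∈ c.flatten := by
  simp only [edges_queryOf, List.mem_toFinset, List.mem_map] at he
  obtain ⟨l, hl, rfl⟩ := he
  exact List.mem_flatten.2 ⟨l, hl, by simpa using hv⟩

theorem exists_mem_edges_of_mem_flatten {v : ℕ} (hv : v ∈ c.flatten) :
    ∃ e ∈ (queryOf c).hypergraph.edges, v ∈ e := by
  obtain ⟨l, hl, h⟩ := List.mem_flatten.1 hv
  exact ⟨l.toFinset, by rw [edges_queryOf]; simpa using ⟨l, hl, rfl⟩, by simpa using h⟩

/-- If `A` held at `v` but not at `v'`, the vertices satisfying `A` would form a cut; an edge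
crossing it contradicts `hA`. As `vs` has no repetitions, `u` has a single position `i`, and
connectivity over `i` is connectivity over `u`. -/
theorem conn_of_mem_relations (hvs : vs.Nodup) (hR : R ∈ relations c k) (u : ℕ) (A : ℕ → Prop)
    (hA : ∀ e ∈ (queryOf c).hypergraph.edges, ∀ v ∈ e, ∀ v' ∈ e,
      u ∈ selectVars vs (labels R v) → u ∈ selectVars vs (labels R v') → A v → A v')
    {v v' : ℕ} (hv : v ∈ c.flatten) (hv' : v' ∈ c.flatten) (hu : u ∈ selectVars vs (labels R v))
    (hu' : u ∈ selectVars vs (labels R v')) (h : A v) : A v' := by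
  classical
  by_contra h'
  have hconn : Connected c k R := by
    rw [relations, List.mem_filter] at hR
    simpa using hR.2
  obtain ⟨i, hi, hui⟩ := mem_selectVars.1 hu
  obtain ⟨j, hj, huj⟩ := mem_selectVars.1 hu'
  rw [mem_labels] at hi hj
  obtain rfl : i = j := by
    obtain ⟨hi', _⟩ := List.getElem?_eq_some_iff.1 hui
    exact (hvs.getElem_inj_iff (hi := hi') (hj := (List.getElem?_eq_some_iff.1 huj).1)).1 (by
      rw [(List.getElem?_eq_some_iff.1 hui).2, (List.getElem?_eq_some_iff.1 huj).2])
  obtain ⟨e, he, ⟨w, hw, hwA, hwi⟩, w', hw', hwA', hwi'⟩ := hconn (c.flatten.filter A)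
    (List.mem_sublists'.2 List.filter_sublist) i (List.mem_range.2 (lt_of_mem_relations hR hi))
    ⟨v, List.mem_filter.2 ⟨hv, by simpa using h⟩, hi⟩ ⟨v', hv', by simp [h'], hj⟩
  refine hwA' (List.mem_filter.2 ⟨List.mem_flatten.2 ⟨e, he, hw'⟩, ?_⟩)
  have := hA e.toFinset (by rw [edges_queryOf]; simpa using ⟨e, he, rfl⟩) w (by simpa using hw) w'
    (by simpa using hw') (mem_selectVars.2 ⟨i, mem_labels.2 hwi, hui⟩)
    (mem_selectVars.2 ⟨i, mem_labels.2 hwi', hui⟩) (by simpa using (List.mem_filter.1 hwA).2)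
  simpa using this

/-- Each `v` is related to the positions in `vs` of the elements of `S v`. A cut without a crossing
edge would be a property that violates `hS.conn`. -/
theorem exists_mem_relations {F : Finset (Finset ℕ)} {S : ℕ → Finset ℕ}
    (hS : IsModel (queryOf c).hypergraph.edges F S) (hF : ∀ f ∈ F, ∀ x ∈ f, x ∈ vs)
    (hk : vs.length ≤ k) :
    ∃ R ∈ relations c k, ∀ v ∈ c.flatten, S v = (selectVars vs (labels R v)).toFinset := by
  classical
  set R : List (ℕ × ℕ) := (c.flatten.flatMap fun v => (List.range k).map fun i => (v, i)).filter
    fun z => ∃ u, vs[z.2]? = some u ∧ u ∈ S z.1 with hR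
  have hmem : ∀ v i, (v, i) ∈ R ↔ (v ∈ c.flatten ∧ i < k) ∧ ∃ u, vs[i]? = some u ∧ u ∈ S v := by
    intro v i
    simp [hR, List.mem_filter, and_assoc]
  refine ⟨R, List.mem_filter.2 ⟨List.mem_sublists'.2 List.filter_sublist, ?_⟩, ?_⟩
  · rw [decide_eq_true_eq]
    rintro A hA i - ⟨v, hv, hvi⟩ ⟨v', hv', hvA', hvi'⟩
    by_contra hno
    obtain ⟨⟨hvc, -⟩, u, hu, hus⟩ := (hmem v i).1 hvi
    obtain ⟨-, u', hu', hus'⟩ := (hmem v' i).1 hvi'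
    obtain rfl : u = u' := Option.some_injective _ (hu.symm.trans hu')
    obtain ⟨e, he, hve⟩ := exists_mem_edges_of_mem_flatten hvc
    obtain ⟨e', he', hve'⟩ := exists_mem_edges_of_mem_flatten hv'
    refine hvA' (hS.conn u (· ∈ A) ?_ e he v hve e' he' v' hve' hus hus' hv)
    intro f hf w hw w' hw' huw huw' hwA
    by_contra hwA'
    have hi := ((hmem v i).1 hvi).1.2
    have h1 := (hmem w i).2 ⟨⟨mem_flatten_of_mem_edges hf hw, hi⟩, u, hu, huw⟩
    have h2 := (hmem w' i).2 ⟨⟨mem_flatten_of_mem_edges hf hw', hi⟩, u, hu, huw'⟩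
    simp only [edges_queryOf, List.mem_toFinset, List.mem_map] at hf
    obtain ⟨l, hl, rfl⟩ := hf
    exact hno ⟨l, hl, ⟨w, by simpa using hw, hwA, h1⟩, w', by simpa using hw', hwA', h2⟩
  · intro v hv
    ext u
    rw [List.mem_toFinset, mem_selectVars]
    constructor
    · intro hu
      obtain ⟨e, he, hve⟩ := exists_mem_edges_of_mem_flatten hv
      obtain ⟨f, hf, h⟩ := hS.sub e he
      obtain ⟨i, hi, rfl⟩ := List.mem_iff_getElem.1 (hF f hf u (h v hve hu))
      exact ⟨i, mem_labels.2 ((hmem v i).2 ⟨⟨hv, hi.trans_le hk⟩, _,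
        List.getElem?_eq_getElem hi, hu⟩), List.getElem?_eq_getElem hi⟩
    · rintro ⟨i, hi, hu⟩
      obtain ⟨-, u', hu', h⟩ := (hmem v i).1 (mem_labels.1 hi)
      rwa [Option.some_injective _ (hu.symm.trans hu')]

open Data

/-- The test at run time checks only the first two clauses of a model. Connectivity does not depend
on the names of the variables and was ensured when `R` was enumerated. -/
theorem good_iff {q : Query} {d : Data} (hR : R ∈ relations c k) :
    Good (cons (ofList ofAtom q) d) (ofModel unary (queryOf c) (labels R)) ↔
      IsModel (queryOf c).hypergraph.edges q.hypergraph.edges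
        fun v => (selectVars q.varList (labels R v)).toFinset := by
  rw [Good, fst_cons, queryVars_ofList, resolve_ofModel, isModelD_iff]
  refine ⟨fun h => ⟨h.1, h.2, ?_⟩, fun h => ⟨h.1, h.2⟩⟩
  intro u A hA e he v hv e' he' v' hv' hu hu'
  refine conn_of_mem_relations (nodup_varList q) hR u A (fun e he v hv v' hv' hu hu' =>
    hA e he v hv v' hv' (by simpa using hu) (by simpa using hu'))
    (mem_flatten_of_mem_edges he hv) (mem_flatten_of_mem_edges he' hv')
    (by simpa using hu) (by simpa using hu')

/-- The hypergraph `M` has at most `k` vertices, and it has a model in the hypergraph with the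
edges in the list `c`. -/
def HasModel (c : List (List ℕ)) (k : ℕ) (M : Hypergraph) : Prop :=
  M.verts.card ≤ k ∧ ∃ S, IsModel (queryOf c).hypergraph.edges M.edges S

/-- The right-hand side does not mention the order or the names of the variables; success of a stage
is thus a property of the hypergraph up to isomorphism. -/
theorem found_candidates_iff {q : Query} {d : Data} :
    Found (cons (ofList ofAtom q) d) (candidates c k) ↔ HasModel c k q.hypergraph := by
  simp only [Found, candidates, toL_ofList, List.mem_map, exists_exists_and_eq_and, HasModel]
  constructor
  · rintro ⟨R, hR, h⟩
    rw [good_iff hR] at h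
    refine ⟨?_, _, h⟩
    rw [← length_varList]
    by_contra hlt
    -- With more than `k` variables, the one at position `k` would have to lie in some image, but
    -- labels are below `k`.
    push Not at hlt
    have hx : q.varList[k] ∈ q.vars := mem_varList.1 (List.getElem_mem hlt)
    obtain ⟨a, ha, hxa⟩ := Query.mem_vars.1 hx
    obtain ⟨e, he, hea⟩ := h.cover _ (Query.mem_edges.2 ⟨a, ha, rfl⟩)
    have hxe : q.varList[k] ∈ a.args.toFinset := by simpa using hxa
    rw [← hea, Finset.mem_biUnion] at hxe
    obtain ⟨v, -, hv⟩ := hxe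
    obtain ⟨i, hi, hui⟩ := mem_selectVars.1 (List.mem_toFinset.1 hv)
    obtain ⟨hi', hui⟩ := List.getElem?_eq_some_iff.1 hui
    have := (nodup_varList q).getElem_inj_iff.1 hui
    have := lt_of_mem_relations hR (mem_labels.1 hi)
    omega
  · rintro ⟨hk, S, hS⟩
    obtain ⟨R, hR, h⟩ := exists_mem_relations (vs := q.varList) (k := k) hS (fun f hf x hx =>
      mem_varList.2 (q.hypergraph.edges_subset f hf hx)) ((length_varList q).trans_le hk)
    exact ⟨R, hR, (good_iff hR).2 (hS.congr fun e he v hv =>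
      h v (mem_flatten_of_mem_edges he hv))⟩

/-! ### Invariance under isomorphism -/

theorem Hypergraph.Iso.symm {H K : Hypergraph} (h : Iso H K) : Iso K H := by
  obtain ⟨φ, hφ, hv, he⟩ := h
  have hleft : ∀ x ∈ H.verts, Function.invFunOn φ H.verts (φ x) = x := fun x hx =>
    hφ.leftInvOn_invFunOn hx
  have himage : ∀ e ⊆ H.verts, (e.image φ).image (Function.invFunOn φ H.verts) = e := by
    intro e h
    rw [Finset.image_image]
    refine (Finset.image_congr fun x hx => ?_).trans Finset.image_id
    exact hleft x (h hx)
  refine ⟨Function.invFunOn φ H.verts, ?_, ?_, ?_⟩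
  · rw [← hv, Finset.coe_image]
    rintro _ ⟨x, hx, rfl⟩ _ ⟨y, hy, rfl⟩ hxy
    rw [hleft x hx, hleft y hy] at hxy
    rw [hxy]
  · rw [← hv]
    exact himage _ subset_rfl
  · rw [← he, Finset.image_image]
    refine (Finset.image_congr fun e h => ?_).trans Finset.image_id
    exact himage e (H.edges_subset e h)

theorem HasModel.of_iso {H K : Hypergraph} (h : Hypergraph.Iso H K) (hH : HasModel c k H) :
    HasModel c k K := by
  obtain ⟨hk, S, hS⟩ := hH
  obtain ⟨T, hT⟩ := h.exists_isModel
  obtain ⟨φ, hφ, hv, -⟩ := h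
  exact ⟨by rwa [← hv, Finset.card_image_of_injOn hφ], _, hS.trans hT⟩

theorem hasModel_iff_of_iso {H K : Hypergraph} (h : Hypergraph.Iso H K) :
    HasModel c k H ↔ HasModel c k K :=
  ⟨.of_iso h, .of_iso h.symm⟩

/-- If a candidate is a model, then the result is an instance with the same value. -/
theorem exists_result {q : Query} {D : Database}
    (h : Found (cons (ofList ofAtom q) (ofList ofAtom D)) (candidates c k)) :
    ∃ D' : Database, result (cons (ofList ofAtom q) (ofList ofAtom D)) (candidates c k) =
        cons (ofList ofAtom (queryOf c)) (ofList ofAtom D') ∧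
      SameSchema (queryOf c) D' ∧
      ((queryOf c).solutions D').ncard = (q.solutions D).ncard := by
  classical
  set x := cons (ofList ofAtom q) (ofList ofAtom D)
  obtain ⟨y, l, hy⟩ : ∃ y l, ((candidates c k).toL.filter fun y => Good x y) = y :: l := by
    refine List.exists_cons_of_ne_nil fun hnil => ?_
    obtain ⟨y, hy, hg⟩ := h
    have : y ∈ (candidates c k).toL.filter fun y => Good x y :=
      List.mem_filter.2 ⟨hy, by simpa using hg⟩
    rw [hnil] at this
    simp at this
  have hy' : y ∈ (candidates c k).toL.filter fun y => Good x y := by simp [hy]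
  obtain ⟨hyc, hg⟩ := List.mem_filter.1 hy'
  rw [decide_eq_true_eq] at hg
  simp only [candidates, toL_ofList, List.mem_map] at hyc
  obtain ⟨R, hR, rfl⟩ := hyc
  rw [good_iff hR] at hg
  set S : ℕ → List ℕ := fun v => selectVars q.varList (labels R v)
  refine ⟨codedFacts (queryOf c) q D S, ?_, ?_, ?_⟩
  · rw [result, hy, ofL, fst_cons, fst_cons, queryVars_ofList, resolve_ofModel, codedInstance_ofModel]
  · refine ⟨fun i => (c.getD i []).length, fun a ha => ?_, fun a ha => ?_⟩
    · simp only [queryOf, List.mem_map] at ha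
      obtain ⟨i, -, rfl⟩ := ha
      rfl
    · simp only [codedFacts, List.mem_flatMap] at ha
      obtain ⟨b, hb, a₀, -, d, -, ha⟩ := ha
      simp only [queryOf, List.mem_map] at hb
      obtain ⟨i, -, rfl⟩ := hb
      split_ifs at ha
      · rw [List.mem_singleton] at ha
        subst ha
        simp [codedFact]
      · simp at ha
  · refine ncard_solutions_eq (S := S) listCode_injective ?_ ?_ hg
    · intro a ha b hb hab
      simp only [queryOf, List.mem_map] at ha hb
      obtain ⟨i, -, rfl⟩ := ha
      obtain ⟨j, -, rfl⟩ := hb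
      simp only at hab
      rw [hab]
    · intro f
      simp only [codedFacts, List.mem_flatMap]
      refine exists_congr fun a => and_congr_right fun _ => exists_congr fun a₀ =>
        and_congr_right fun _ => exists_congr fun d => and_congr_right fun _ => ?_
      split_ifs with h <;> simp [h]

/-! ### The search for a model -/

theorem exists_eval_le (P : Polynomial ℕ) : ∃ C, ∀ n, 1 ≤ n → P.eval n ≤ C * n ^ C := by
  induction P using Polynomial.induction_on' with
  | add p q hp hq =>
    obtain ⟨C, hC⟩ := hp
    obtain ⟨D, hD⟩ := hq
    refine ⟨C + D, fun n hn => ?_⟩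
    have h1 : C * n ^ C ≤ C * n ^ (C + D) :=
      Nat.mul_le_mul_left _ (Nat.pow_le_pow_right hn (Nat.le_add_right _ _))
    have h2 : D * n ^ D ≤ D * n ^ (C + D) :=
      Nat.mul_le_mul_left _ (Nat.pow_le_pow_right hn (Nat.le_add_left _ _))
    have h3 := hC n hn
    have h4 := hD n hn
    rw [Polynomial.eval_add, Nat.add_mul]
    omega
  | monomial d a =>
    refine ⟨a + d, fun n hn => ?_⟩
    rw [Polynomial.eval_monomial]
    exact Nat.mul_le_mul (Nat.le_add_right _ _) (Nat.pow_le_pow_right hn (Nat.le_add_left _ _))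

/-- The sum of the first `n + 1` values of `τ`, plus `n`. -/
def budget (τ : ℕ → ℕ) (n : ℕ) : ℕ := n + ∑ k ∈ Finset.range (n + 1), τ k

theorem le_budget (τ : ℕ → ℕ) {k n : ℕ} (h : k ≤ n) : τ k + n ≤ budget τ n := by
  have := Finset.single_le_sum (f := τ) (fun _ _ => Nat.zero_le _)
    (Finset.mem_range.2 (show k < n + 1 by omega))
  rw [budget]
  omega

theorem computable_budget {τ : ℕ → ℕ} (h : Computable τ) : Computable (budget τ) := by
  have h1 : Computable₂ fun (n : ℕ) (y : ℕ × ℕ) => y.2 + τ y.1 :=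
    Primrec.nat_add.to_comp.comp (Computable.snd.comp Computable.snd)
      (h.comp (Computable.fst.comp Computable.snd))
  have h2 : Computable fun n : ℕ => ∑ k ∈ Finset.range n, τ k := by
    refine (Computable.nat_rec (f := fun n : ℕ => n) (g := fun _ => 0) Computable.id
      (Computable.const 0) h1).of_eq fun n => ?_
    have : ∀ m : ℕ, (Nat.rec 0 (fun y ih => ih + τ y) m : ℕ) = ∑ k ∈ Finset.range m, τ k := by
      intro m
      induction m with
      | zero => rfl
      | succ m ih => rw [Finset.sum_range_succ, ← ih]
    exact this n
  exact Primrec.nat_add.to_comp.comp Computable.id (h2.comp Computable.succ)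

/-- The states of the search. -/
def searchState (E : ℕ → Data) (x : Data) (k : ℕ) : Data := .cons x (.cons (.unary k) (E k))

theorem size_searchState_le {E : ℕ → Data} {τ : ℕ → ℕ} (hE : ∀ k, (E k).size ≤ τ k) (x : Data)
    {k n : ℕ} (h : k ≤ n) : (searchState E x k).size ≤ 3 * (x.size + budget τ n) + 10 := by
  have h1 := hE k
  have h2 := le_budget τ h
  simp only [searchState, size, size_unary]
  omega

/-- Reaching stage `n` takes `n` rounds, and each computes its list of candidates afresh from the
unary stage number. Both the number of rounds and the cost of each list are at most `budget τ n`;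
the rest is polynomial in the size of the state. -/
theorem exists_search {p : Prog} {E : ℕ → Data} {τ : ℕ → ℕ}
    (hp : ∀ k, Runs p (.unary k) (E k) (τ k)) :
    ∃ (r : Prog) (Q : Polynomial ℕ), ∀ x n, Found x (E n) → (∀ k < n, ¬ Found x (E k)) →
      ∃ t ≤ Q.eval (x.size + budget τ n), Runs r x (searchState E x n) t := by
  classical
  -- The test is negated: the loop goes on as long as nothing is found.
  obtain ⟨test, ⟨pt, P, hP⟩, htest⟩ :=
    (PolyDec.found (A := fun s => s.fst) (B := fun s => s.snd.snd) (.fst .id)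
      (.snd (.snd .id))).not
  have hsize : ∀ k, (E k).size ≤ τ k := fun k => (hp k).size_output_le
  let step : Prog := .pair .fst (.comp (.pair .nil (.comp .snd .fst)) (.pair .id p))
  let stepFun : Data → Data := fun s =>
    searchState E s.fst (s.snd.fst.toL.length + 1)
  have hstep : ∀ x k n, k < n → ∃ t ≤ 20 * (3 * (x.size + budget τ n) + 10),
      Runs step (searchState E x k) (searchState E x (k + 1)) t := by
    intro x k n hk
    have h1 := size_searchState_le hsize x hk.le
    have h2 := le_budget τ (show k + 1 ≤ n from hk)
    refine ⟨_, ?_, .pair (.fst _) (.comp (.pair (.nil _) (.comp (.snd _) (.fst _)))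
      (.pair (.id (.unary (k + 1))) (hp (k + 1))))⟩
    have h3 : (searchState E x k).snd.size ≤ (searchState E x k).size := size_snd_le _
    have h4 : (Data.cons .nil (searchState E x k).snd.fst).size = 2 * k + 3 := by
      simp only [searchState, snd_cons, fst_cons, size, size_unary]
      omega
    rw [size_unary, h4]
    omega
  refine ⟨.comp (.pair .id (.comp .nil (.pair .id p))) (.loop pt step),
    (.X + 1) * (3 * (P.comp (3 * .X + 10) + 20 * (3 * .X + 10))) + 10 * (3 * .X + 10),
    fun x n hn hlt => ?_⟩
  obtain ⟨y, t, hr, ⟨k, hk, rfl⟩, hy, ht⟩ := runs_loop (p := pt) (q := step) (test := test)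
    (step := stepFun) (τ := P.eval (3 * (x.size + budget τ n) + 10) +
      20 * (3 * (x.size + budget τ n) + 10))
    (fun s => ∃ k ≤ n, s = searchState E x k) (fun s => n - s.snd.fst.toL.length)
    (by
      rintro s ⟨k, hk, rfl⟩
      obtain ⟨t, ht, hr⟩ := hP (searchState E x k)
      have := eval_le_eval P (size_searchState_le hsize x hk)
      exact ⟨t, by omega, hr⟩)
    (by
      rintro s ⟨k, hk, rfl⟩ hne
      rw [htest] at hne
      have hkn : k ≠ n := fun h => hne (h ▸ hn)
      have hlt : k < n := lt_of_le_of_ne hk hkn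
      obtain ⟨t, ht, hr⟩ := hstep x k n hlt
      have hs : stepFun (searchState E x k) = searchState E x (k + 1) := by
        simp [stepFun, searchState]
      rw [hs]
      refine ⟨⟨t, by omega, hr⟩, ⟨k + 1, hlt, rfl⟩, ?_⟩
      simp only [searchState, fst_cons, snd_cons, length_toL_unary]
      omega)
    (searchState E x 0) ⟨0, Nat.zero_le _, rfl⟩
  -- The invariant gives `k ≤ n`, and stopping before `n` would mean an earlier success.
  have hkn : k = n := by
    by_contra hne
    exact (htest (searchState E x k)).2 (hlt k (lt_of_le_of_ne hk hne)) hy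
  subst hkn
  refine ⟨_, ?_, .comp (.pair (.id x) (.comp (.nil x) (.pair (.id (.unary 0)) (hp 0)))) hr⟩
  have h1 := le_budget τ (Nat.zero_le k)
  have h2 := x.one_le_size
  have h3 : (k - (searchState E x 0).snd.fst.toL.length + 1) ≤ x.size + budget τ k + 1 := by omega
  have h4 := Nat.mul_le_mul_right (3 * (P.eval (3 * (x.size + budget τ k) + 10) +
      20 * (3 * (x.size + budget τ k) + 10))) h3
  simp only [Polynomial.eval_add, Polynomial.eval_mul, Polynomial.eval_X, Polynomial.eval_one,
    Polynomial.eval_ofNat, Polynomial.eval_comp, size_unary, Data.size] at ht h4 ⊢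
  omega

/-! ### The parameter bound and the assembly of the reduction -/

theorem size_hypergraph_le (p : Query) : p.hypergraph.size ≤ (ofList ofAtom p).size := by
  have h1 : p.hypergraph.edges.card ≤ p.length :=
    (List.toFinset_card_le _).trans (by simp)
  have h2 : p.hypergraph.verts.card ≤ (p.map fun a => a.args.length).sum :=
    (List.toFinset_card_le _).trans (by simp [List.length_flatMap])
  have h3 : (p.map fun a => a.args.length).sum + p.length ≤ (ofList ofAtom p).size := by
    clear h1 h2
    induction p with
    | nil => simp
    | cons a p ih =>
      have h4 := length_toL_le (ofList ofNat a.args)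
      rw [toL_ofList, List.length_map] at h4
      simp only [List.map_cons, List.sum_cons, List.length_cons, ofList, size, ofAtom] at ih ⊢
      omega
  rw [Hypergraph.size]
  omega

/-- Every candidate contains all atoms of the query, so the time spent on producing the candidates
bounds the new parameter. -/
theorem size_queryOf_le {c : List (List ℕ)} {k : ℕ} {x : Data} (h : Found x (candidates c k)) :
    (queryOf c).hypergraph.size ≤ (candidates c k).size := by
  obtain ⟨y, hy, -⟩ := h
  refine le_trans ?_ (size_lt_of_mem_toL hy).le
  simp only [candidates, toL_ofList, List.mem_map] at hy
  obtain ⟨R, -, rfl⟩ := hy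
  refine (size_hypergraph_le _).trans ?_
  rw [ofModel]
  induction queryOf c with
  | nil => exact le_rfl
  | cons a p ih => simp only [ofList, size] at ih ⊢; omega

/-- Without isolated vertices, the edges determine the vertex set. This is what puts the hypergraph
of the constructed query into the class `𝓗` itself. -/
theorem hypergraph_eq_of_edges_eq {q : Query} {H : Hypergraph} (hH : H.NoIsolated)
    (h : q.hypergraph.edges = H.edges) : q.hypergraph = H := by
  obtain ⟨V, F, hV⟩ := H
  have h : q.hypergraph.edges = F := h
  have hv : q.hypergraph.verts = V := by
    refine subset_antisymm (fun x hx => ?_) fun x hx => ?_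
    · obtain ⟨a, ha, hxa⟩ := Query.mem_vars.1 hx
      exact hV _ (h ▸ Query.mem_edges.2 ⟨a, ha, rfl⟩) (List.mem_toFinset.2 hxa)
    · obtain ⟨e, he, hxe⟩ := hH x hx
      exact q.hypergraph.edges_subset e (h ▸ he) hxe
  subst hv h
  rfl

theorem noIsolated_hypergraph (q : Query) : q.hypergraph.NoIsolated := by
  intro x hx
  obtain ⟨a, ha, hxa⟩ := Query.mem_vars.1 hx
  exact ⟨_, Query.mem_edges.2 ⟨a, ha, rfl⟩, List.mem_toFinset.2 hxa⟩

/-- This input, with an empty database, serves to compute the bounds from a representation of the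
parameter: the search inspects the query only. -/
theorem primrec_encode_queryOf :
    Primrec fun c : List ℕ × List (List ℕ) => Data.cons (ofList ofAtom (queryOf c.2)) .nil := by
  have h : Primrec fun c : List ℕ × List (List ℕ) =>
      ofList (fun i => ofAtom ⟨i, c.2.getD i []⟩) (List.range c.2.length) :=
    primrec_ofList₂ (Primrec.list_range.comp (Primrec.list_length.comp Primrec.snd))
      (primrec_ofAtom Primrec.snd ((Primrec.list_getD []).comp (Primrec.snd.comp Primrec.fst)
        Primrec.snd))
  refine (primrec_cons.comp h (.const .nil)).of_eq fun c => ?_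
  congr 1
  refine eq_of_toL_eq ?_
  simp only [queryOf, toL_ofList, List.map_map]
  rfl

/-- The number of the first stage at which a model of `M` is found. -/
noncomputable def firstStage (g : ℕ → Option (List ℕ × List (List ℕ))) (M : Hypergraph) : ℕ :=
  sInf {k | ∃ c, g k = some c ∧ HasModel c.2 k M}

theorem firstStage_isoInvariant (g : ℕ → Option (List ℕ × List (List ℕ))) {H K : Hypergraph}
    (h : Hypergraph.Iso H K) : firstStage g H = firstStage g K := by
  simp only [firstStage, hasModel_iff_of_iso h]

theorem fptReducible_of_isModel {𝓗 𝓜 : Set Hypergraph} (hre : Hypergraph.IsRE 𝓗)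
    (hiso : ∀ H ∈ 𝓗, H.NoIsolated)
    (hmodel : ∀ M ∈ 𝓜, ∃ H ∈ 𝓗, ∃ S, IsModel H.edges M.edges S) :
    FptReducible (pCountCQ 𝓜) (pCountCQ 𝓗) := by
  classical
  obtain ⟨g, hg, hgP, hgex⟩ := exists_enumeration hre
  set E : ℕ → Data := fun k => (g k).casesOn .nil fun c => candidates c.2 k with hE
  have hEc : Computable E := Computable.option_casesOn hg (Computable.const _)
    (primrec_candidates.to_comp.comp (Computable.snd.comp Computable.snd) Computable.fst).to₂
  obtain ⟨p, hp⟩ := exists_prog_of_computable hEc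
  choose τ hτ using hp
  have hτc : Computable τ := by
    have h : Partrec fun k => (p.eval (unary k)).map Prod.snd :=
      (p.partrec_eval.comp primrec_unary.to_comp).map (Computable.snd.comp Computable.snd).to₂
    exact h.of_eq_tot fun k => Part.mem_map Prod.snd (hτ k).mem_eval
  have hfound : ∀ (q : Query) (d : Data) (k : ℕ), Found (.cons (ofList ofAtom q) d) (E k) ↔
      ∃ c, g k = some c ∧ HasModel c.2 k q.hypergraph := by
    intro q d k
    cases h : g k with
    | none => simp [hE, h, Found]
    | some c => simp [hE, h, found_candidates_iff]
  have hstage : ∀ M ∈ 𝓜, ∀ q : Query, q.hypergraph = M → ∀ d,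
      Found (.cons (ofList ofAtom q) d) (E (firstStage g M)) ∧
      ∀ k < firstStage g M, ¬ Found (.cons (ofList ofAtom q) d) (E k) := by
    rintro M hM q rfl d
    have hne : {k | ∃ c, g k = some c ∧ HasModel c.2 k q.hypergraph}.Nonempty := by
      obtain ⟨H, hH, S, hS⟩ := hmodel _ hM
      have hrep : H.RepresentedBy (H.verts.toList, H.edges.toList.map Finset.toList) := by
        constructor
        · simp
        · simp [Function.comp_def]
      -- Late recurrence in the enumeration gives a stage at which `k` is at least the number of
      -- vertices.
      obtain ⟨k, hk, hgk⟩ := hgex _ ⟨H, hH, hrep⟩ q.hypergraph.verts.card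
      exact ⟨k, _, hgk, hk, S, by rw [edges_queryOf, hrep.2]; exact hS⟩
    refine ⟨(hfound q d _).2 (Nat.sInf_mem hne), fun k hk h => ?_⟩
    exact Nat.notMem_of_lt_sInf hk ((hfound q d k).1 h)
  obtain ⟨r, Q, hr⟩ := exists_search hτ
  -- The first stage is found by running the search on a query with the represented hypergraph. It
  -- is read off the final state, where it stands in unary with size `2 * n + 1`.
  have hcomp : ∀ φ : ℕ → ℕ, Computable φ → Hypergraph.ComputableOn
      ((pCountCQ 𝓜).param '' (pCountCQ 𝓜).instances) fun M => φ (firstStage g M) := by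
    intro φ hφ
    refine ⟨fun c => (r.eval (.cons (ofList ofAtom (queryOf c.2)) .nil)).map
      fun y => φ ((y.1.snd.fst.size - 1) / 2), ?_, ?_⟩
    · have h : Computable₂ fun (_ : List ℕ × List (List ℕ)) (y : Data × ℕ) =>
          φ ((y.1.snd.fst.size - 1) / 2) := ?_
      · exact (r.partrec_eval.comp primrec_encode_queryOf.to_comp).map h
      refine hφ.comp (Primrec.to_comp ?_)
      exact Primrec.nat_div.comp (Primrec.nat_sub.comp (primrec_size.comp (primrec_fst.comp
        (primrec_snd.comp (Primrec.fst.comp Primrec.snd)))) (.const 1)) (.const 2)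
    · rintro _ ⟨⟨q, D⟩, ⟨hq, -⟩, rfl⟩ c hc
      have hqc : (queryOf c.2).hypergraph = q.hypergraph :=
        hypergraph_eq_of_edges_eq (noIsolated_hypergraph q) (by rw [edges_queryOf]; exact hc.2)
      obtain ⟨h1, h2⟩ := hstage _ hq (queryOf c.2) hqc .nil
      obtain ⟨t, -, ht⟩ := hr _ _ h1 h2
      refine (Part.mem_map_iff _).2 ⟨_, ht.mem_eval, ?_⟩
      simp only [searchState, snd_cons, fst_cons, size_unary]
      rw [Nat.add_sub_cancel, Nat.mul_div_cancel_left _ (by norm_num)]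
      rfl
  obtain ⟨u, U, hU⟩ := PolyTime.result (A := fun s => s.fst) (B := fun s => s.snd.snd)
    (.fst .id) (.snd (.snd .id))
  obtain ⟨C, hC⟩ := exists_eval_le (Q + U.comp (3 * .X + 10) + .X)
  have hf := computable_budget hτc
  refine ⟨.comp r u, fun M => C * (budget τ (firstStage g M) + 1) ^ C,
    fun M => budget τ (firstStage g M), C, ?_, ?_, ?_, ?_, ?_⟩
  · have hpow : Primrec fun n : ℕ => C * (n + 1) ^ C := by
      have : ∀ m : ℕ, Primrec fun n : ℕ => (n + 1) ^ m := by
        intro m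
        induction m with
        | zero => simpa using Primrec.const 1
        | succ m ih => simpa only [pow_succ] using Primrec.nat_mul.comp ih Primrec.succ
      exact Primrec.nat_mul.comp (.const C) (this C)
    exact hcomp _ (hpow.to_comp.comp hf)
  · exact fun H K h => by simp only [firstStage_isoInvariant g h]
  · exact hcomp _ hf
  · exact fun H K h => by simp only [firstStage_isoInvariant g h]
  · rintro ⟨q, D⟩ ⟨hq, -⟩
    obtain ⟨h1, h2⟩ := hstage _ hq q rfl (ofList ofAtom D)
    obtain ⟨c, hgc, -⟩ := (hfound _ _ _).1 h1
    obtain ⟨t, ht, hrun⟩ := hr _ _ h1 h2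
    set n := firstStage g q.hypergraph
    set x := Data.cons (ofList ofAtom q) (ofList ofAtom D) with hx
    have hEn : E n = candidates c.2 n := by simp [hE, hgc]
    rw [hEn] at h1
    obtain ⟨D', hres, hschema, hcount⟩ := exists_result h1
    obtain ⟨H, hH, hrep⟩ := hgP _ _ hgc
    have hyp : (queryOf c.2).hypergraph = H :=
      hypergraph_eq_of_edges_eq (hiso H hH) (by rw [edges_queryOf]; exact hrep.2)
    obtain ⟨t', ht', hrun'⟩ := hU (searchState E x n)
    have hsize : ∀ k, (E k).size ≤ τ k := fun k => (hτ k).size_output_le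
    refine ⟨(queryOf c.2, D'), ⟨?_, hschema⟩, t + t' + x.size, ?_, ?_, ?_, hcount⟩
    · rw [hyp]
      exact hH
    · have h : result (searchState E x n).fst (searchState E x n).snd.snd =
          .cons (ofList ofAtom (queryOf c.2)) (ofList ofAtom D') := by
        rw [searchState, fst_cons, snd_cons, snd_cons, hEn, hres]
      dsimp only at hrun'
      rw [h] at hrun'
      exact .comp hrun hrun'
    · have h3 := eval_le_eval U (size_searchState_le hsize x (le_refl n))
      have h4 := x.one_le_size
      have h5 := hC (x.size + budget τ n) (by omega)
      simp only [Polynomial.eval_add, Polynomial.eval_comp, Polynomial.eval_mul,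
        Polynomial.eval_X, Polynomial.eval_ofNat] at h5
      -- Since `x.size` is positive, the sum is at most a product, which separates the parameter
      -- from the input size.
      have h6 : x.size + budget τ n ≤ (budget τ n + 1) * x.size := by nlinarith
      calc t + t' + x.size ≤ C * (x.size + budget τ n) ^ C := by omega
        _ ≤ C * ((budget τ n + 1) * x.size) ^ C :=
          Nat.mul_le_mul_left _ (Nat.pow_le_pow_left h6 _)
        _ = C * (budget τ n + 1) ^ C * x.size ^ C := by rw [mul_pow, mul_assoc]
    · have h3 := size_queryOf_le h1
      have h4 := hsize n
      have h5 := le_budget τ (le_refl n)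
      rw [hEn] at h4
      exact (h3.trans h4).trans (show τ n ≤ budget τ n by omega)

end CQDilution

theorem mainTheorem11 (𝓗 𝓜 : Set CQDilution.Hypergraph)
    (hre : CQDilution.Hypergraph.IsRE 𝓗)
    (hiso : ∀ H ∈ 𝓗, H.NoIsolated)
    (hdil : ∀ M ∈ 𝓜, ∃ H ∈ 𝓗, M.IsDilutionOf H) :
    CQDilution.FptReducible (CQDilution.pCountCQ 𝓜) (CQDilution.pCountCQ 𝓗) := by
  refine CQDilution.fptReducible_of_isModel hre hiso fun M hM => ?_
  obtain ⟨H, hH, h⟩ := hdil M hM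
  exact ⟨H, hH, h.exists_isModel (hiso H hH)⟩
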